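/- Let $N\ge 2$ and $p>2$, and let $k,Q\in C^1([0,\infty),\mathbb R)$ be nonincreasing with limits $k(r)\to k_\infty>0$ and $Q(r)\to Q_\infty\in\mathbb R$ as $r\to\infty$. Write $$G(0,z)=\frac{k(0)^2}{2}z^2+\frac{Q(0)}{p}|z|^p,\qquad G_\infty(z)=\frac{k_\infty^2}{2}z^2+\frac{Q_\infty}{p}|z|^p .$$ Then there is an open interval $I\subseteq\mathbb R$ containing $0$, with $I=\mathbb R$ in case $Q_\infty\ge 0$, and a family $\mathcal C=\{u_\alpha:\alpha\in I\}\subseteq C^2(\mathbb R^N)$ which is connected with respect to uniform convergence on $\mathbb R^N$ of the zeroth, first and second derivatives, such that every $u_\alpha$ is a radially symmetric classical solution of $$-\Delta u-k(|x|)^2u=Q(|x|)\,|u|^{p-2}u\quad\text{in }\mathbb R^N,\qquad u_\alpha(0)=\alpha,$$ that is oscillating (it has an unbounded sequence of zeros). Moreover, writing $u_\alpha(x)=u_\alpha(|x|)$ for the radial profile (extended to an even $C^2$ function on $\mathbb R$), for each $\alpha\in I$: (i) there is a number $\alpha^*\ge 0$ with $\max\{-Q_\infty,0\}\,(\alpha^*)^{p-2}<k_\infty^2$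 and $G_\infty(\alpha^*)=G(0,\alpha)$ (these conditions determine $\alpha^*$ uniquely) such that $$\|u_\alpha\|_{L^\infty(\mathbb R)}\le\alpha^*\qquad\text{and}\qquad \|u_\alpha'\|_{L^\infty(\mathbb R)}\le\sqrt{2G(0,\alpha)};$$ (ii) if $\alpha\ne 0$, there are $c,C>0$ (depending on $\alpha$) such that $$c\,r^{(1-N)/2}\le |u_\alpha(r)|+|u_\alpha'(r)|+|u_\alpha''(r)|\le C\,r^{(1-N)/2}\qquad\text{for all }r\ge 1 .$$ -/

import Mathlib

open Set Filter Topology InnerProductSpace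

noncomputable section

namespace NonlinearHelmholtz

/-- The space `C²(E)` of twice continuously differentiable real functions on `E`. -/
structure C2Function (E : Type*) [NormedAddCommGroup E] [NormedSpace ℝ E] where
  /-- the underlying function -/
  toFun : E → ℝ
  contDiff : ContDiff ℝ 2 toFun

instance {E : Type*} [NormedAddCommGroup E] [NormedSpace ℝ E] :
    CoeFun (C2Function E) (fun _ => E → ℝ) :=
  ⟨C2Function.toFun⟩

/-- The 2-jet `x ↦ (f x, Df x, D²f x)`. -/
def C2Function.jet {E : Type*} [NormedAddCommGroup E] [NormedSpace ℝ E] (f : C2Function E)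
    (x : E) : ℝ × (E →L[ℝ] ℝ) × (E →L[ℝ] E →L[ℝ] ℝ) :=
  (f x, fderiv ℝ f x, fderiv ℝ (fderiv ℝ f) x)

/-- The topology on `C²(E)` of uniform convergence, on all of `E`, of the zeroth, first and second
derivatives. -/
instance {E : Type*} [NormedAddCommGroup E] [NormedSpace ℝ E] :
    TopologicalSpace (C2Function E) :=
  TopologicalSpace.induced (fun f => UniformFun.ofFun f.jet) inferInstance

/-- `u` solves `-Δu - k(|x|)² u = Q(|x|) |u|^(p-2) u` at every point of `ℝᴺ`. -/
def SolvesHelmholtz {N : ℕ} (k Q : ℝ → ℝ) (p : ℝ) (u : EuclideanSpace ℝ (Fin N) → ℝ) : Prop :=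
  ∀ x, -(Laplacian.laplacian u x) - k ‖x‖ ^ 2 * u x = Q ‖x‖ * |u x| ^ (p - 2) * u x

/-- `u` is oscillating: it has an unbounded sequence of zeros. -/
def IsOscillating {E : Type*} [NormedAddCommGroup E] (u : E → ℝ) : Prop :=
  ∃ x : ℕ → E, (∀ n, u (x n) = 0) ∧ ¬ Bornology.IsBounded (range x)

/-- The primitive `z ↦ κ²/2 z² + q/p |z|^p` of `z ↦ κ² z + q |z|^(p-2) z`. -/
def primitive (p κ q z : ℝ) : ℝ :=
  κ ^ 2 / 2 * z ^ 2 + q / p * |z| ^ p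

/-- `w` is the profile of the radially symmetric function `u`, that is `u(x) = w(|x|)`. The profile
is extended evenly to the whole line, which determines it. -/
def IsRadialProfile {E : Type*} [NormedAddCommGroup E] (u : E → ℝ) (w : ℝ → ℝ) : Prop :=
  Function.Even w ∧ ∀ x, u x = w ‖x‖

end NonlinearHelmholtz

end

/-! A radial solution u(x) = w(|x|) solves the singular problem w'' + (n/r) w' + k² w + Q|w|^(p-2) w
= 0, w(0) = α, w'(0) = 0, with n = N - 1. Writing w' = r φ with φ continuous up to r = 0 removes the
apparent singularity from the equation and from the gradient and Hessian of u.

Everything rests on the energy E = w'²/2 + G(r, w), which is nonincreasing because of the friction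
and because k and Q decrease. Let b be an amplitude up to which the limit nonlinearity is coercive,
with G(0, α) < G_∞(b). Then w never reaches ±b, since the energy there would be at least G_∞(b). So
the nonlinearity may be truncated at b, the problem solved by contraction (`exists_radialSolution`),
and the truncation removed. The same energy comparison gives (i), and I is the set of α for which
such a b exists.

For (ii), adding a multiple of w w'/r to E yields a crude decay r^(-γ) (`exists_sq_add_sq_le_rpow`).
The energy of r^(n/2) w then has a logarithmic derivative dominated by an integrable function: k'
and Q' are integrable by monotonicity, and |w|^(p-2)/r is integrable by the crude decay. A two-sided
Gronwall estimate (`exists_scaledEnergy_bounds`) bounds this energy above and away from 0.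
Oscillation is Sturm comparison of r^(n/2) w with a sine (`exists_zero_ge`).

The family is connected because α ↦ u_α is continuous into C² on the interval I. On a bounded range
of radii this is Gronwall; on the tail both solutions are small, because E is small at one radius
and never grows (`exists_delta`). -/

noncomputable section

namespace NonlinearHelmholtz

/-! ### Radial functions of class `C²` -/

section Radial

set_option maxSynthPendingDepth 3

variable {E : Type*} [NormedAddCommGroup E] [InnerProductSpace ℝ E]

/-- The real inner product as a continuous bilinear map. -/
def innerCLM (E : Type*) [NormedAddCommGroup E] [InnerProductSpace ℝ E] :
    E →L[ℝ] E →L[ℝ] ℝ := innerSL ℝ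

@[simp]
theorem innerCLM_apply (x y : E) : innerCLM E x y = inner ℝ x y := rfl

theorem norm_innerCLM_apply (x : E) : ‖innerCLM E x‖ = ‖x‖ := innerSL_apply_norm ℝ x

theorem norm_innerCLM_le : ‖innerCLM E‖ ≤ 1 :=
  ContinuousLinearMap.opNorm_le_bound _ zero_le_one fun x => by
    rw [norm_innerCLM_apply, one_mul]

theorem hasFDerivAt_norm_of_ne_zero {x : E} (hx : x ≠ 0) :
    HasFDerivAt (fun y : E => ‖y‖) (‖x‖⁻¹ • innerCLM E x) x := by
  have h1 : HasFDerivAt (fun y : E => ‖y‖ ^ 2) (2 • innerCLM E x) x :=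
    (hasStrictFDerivAt_norm_sq x).hasFDerivAt
  have hx' : ‖x‖ ≠ 0 := norm_ne_zero_iff.2 hx
  have h2 := h1.sqrt (pow_ne_zero 2 hx')
  have h3 : (fun y : E => √(‖y‖ ^ 2)) = fun y : E => ‖y‖ := by
    funext y
    exact Real.sqrt_sq (norm_nonneg y)
  rw [h3, Real.sqrt_sq (norm_nonneg x)] at h2
  refine h2.congr_fderiv ?_
  ext y
  simp
  field_simp

/-- The Hessian of a radial function with profile derivatives `r φ(r)` and `ψ(r)`. -/
def radialHessian (φ ψ : ℝ → ℝ) (x : E) : E →L[ℝ] E →L[ℝ] ℝ :=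
  φ ‖x‖ • innerCLM E +
    ((ψ ‖x‖ - φ ‖x‖) / ‖x‖ ^ 2) • (innerCLM E x).smulRight (innerCLM E x)

theorem radialHessian_apply (φ ψ : ℝ → ℝ) (x y z : E) :
    radialHessian φ ψ x y z =
      φ ‖x‖ * inner ℝ y z + (ψ ‖x‖ - φ ‖x‖) / ‖x‖ ^ 2 * (inner ℝ x y * inner ℝ x z) := by
  simp [radialHessian]

theorem norm_rankOne_le (c : ℝ) (x : E) :
    ‖(c / ‖x‖ ^ 2) • (innerCLM E x).smulRight (innerCLM E x)‖ ≤ |c| := by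
  rw [norm_smul, ContinuousLinearMap.norm_smulRight_apply, norm_innerCLM_apply, Real.norm_eq_abs,
    abs_div, abs_of_nonneg (sq_nonneg ‖x‖), ← sq]
  rcases eq_or_ne (‖x‖ ^ 2) 0 with h | h
  · rw [h, mul_zero]; exact abs_nonneg c
  · rw [div_mul_cancel₀ _ h]

theorem radialHessian_sub (φ ψ φ' ψ' : ℝ → ℝ) (x : E) :
    radialHessian φ ψ x - radialHessian φ' ψ' x = radialHessian (φ - φ') (ψ - ψ') x := by
  ext y z
  simp only [_root_.sub_apply, radialHessian_apply, Pi.sub_apply]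
  ring

theorem norm_radialHessian_le (φ ψ : ℝ → ℝ) (x : E) :
    ‖radialHessian φ ψ x‖ ≤ 2 * |φ ‖x‖| + |ψ ‖x‖| := by
  have h1 : ‖φ ‖x‖ • innerCLM E‖ ≤ |φ ‖x‖| := by
    rw [norm_smul, Real.norm_eq_abs]
    exact mul_le_of_le_one_right (abs_nonneg _) norm_innerCLM_le
  have h2 := norm_rankOne_le (ψ ‖x‖ - φ ‖x‖) x
  have h3 := abs_sub (ψ ‖x‖) (φ ‖x‖)
  have h4 := norm_add_le (φ ‖x‖ • innerCLM E)
    (((ψ ‖x‖ - φ ‖x‖) / ‖x‖ ^ 2) • (innerCLM E x).smulRight (innerCLM E x))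
  unfold radialHessian
  linarith

/-- The profile data of a radial `C²` function: `w' = r φ` and `w'' = ψ`. -/
structure RadialJet (w φ ψ : ℝ → ℝ) : Prop where
  hasDerivAt : ∀ r, 0 ≤ r → HasDerivAt w (r * φ r) r
  hasDerivAt_deriv : ∀ r, 0 < r → HasDerivAt (fun r => r * φ r) (ψ r) r
  continuousOn_fst : ContinuousOn φ (Ici 0)
  continuousOn_snd : ContinuousOn ψ (Ici 0)
  apply_zero : ψ 0 = φ 0

variable {w φ ψ : ℝ → ℝ}

/-- Off the origin this is the chain rule through the norm. At the origin the norm is not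
differentiable, but w'(0) = 0 makes w(|y|) - w(0) of order o(|y|). -/
theorem RadialJet.hasFDerivAt (h : RadialJet w φ ψ) (x : E) :
    HasFDerivAt (fun y : E => w ‖y‖) (φ ‖x‖ • innerCLM E x) x := by
  rcases eq_or_ne x 0 with rfl | hx
  · have h0 := h.hasDerivAt 0 le_rfl
    rw [hasDerivAt_iff_isLittleO] at h0
    have h1 := h0.comp_tendsto (k := fun y : E => ‖y‖) (l' := 𝓝 (0 : E))
      (by simpa using (continuous_norm (E := E)).tendsto 0)
    refine HasFDerivAt.of_isLittleO ?_
    refine (h1.congr_left fun y => ?_).trans_isBigO ?_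
    · simp
    · refine Asymptotics.IsBigO.of_bound 1 (Eventually.of_forall fun y => ?_)
      simp
  · have hx' : 0 < ‖x‖ := norm_pos_iff.2 hx
    refine ((h.hasDerivAt ‖x‖ hx'.le).comp_hasFDerivAt x
      (hasFDerivAt_norm_of_ne_zero hx)).congr_fderiv ?_
    ext y
    simp
    field_simp

theorem RadialJet.continuous_norm_fst {E : Type*} [NormedAddCommGroup E]
    (h : RadialJet w φ ψ) : Continuous fun x : E => φ ‖x‖ :=
  h.continuousOn_fst.comp_continuous continuous_norm fun x => norm_nonneg x

theorem RadialJet.continuous_norm_snd {E : Type*} [NormedAddCommGroup E]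
    (h : RadialJet w φ ψ) : Continuous fun x : E => ψ ‖x‖ :=
  h.continuousOn_snd.comp_continuous continuous_norm fun x => norm_nonneg x

theorem RadialJet.hasDerivAt_fst (h : RadialJet w φ ψ) {r : ℝ} (hr : 0 < r) :
    HasDerivAt φ ((ψ r - φ r) / r) r := by
  have h1 := (hasDerivAt_inv hr.ne').mul (h.hasDerivAt_deriv r hr)
  have h2 : φ =ᶠ[𝓝 r] fun s => s⁻¹ * (s * φ s) := by
    filter_upwards [lt_mem_nhds hr] with s hs
    rw [inv_mul_cancel_left₀ (ne_of_gt hs)]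
  refine (h1.congr_of_eventuallyEq h2).congr_deriv ?_
  field_simp
  ring

/-- Off the origin φ' = (ψ - φ)/r. At the origin continuity of φ alone shows that φ(|y|) y has
derivative φ(0) times the identity. -/
theorem RadialJet.hasFDerivAt_gradient (h : RadialJet w φ ψ) (x : E) :
    HasFDerivAt (fun y : E => φ ‖y‖ • innerCLM E y) (radialHessian φ ψ x) x := by
  rcases eq_or_ne x 0 with rfl | hx
  · have hc : Tendsto (fun y : E => φ ‖y‖ - φ 0) (𝓝 0) (𝓝 0) := by
      have := (h.continuous_norm_fst (E := E)).tendsto 0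
      simpa using this.sub_const (φ 0)
    refine HasFDerivAt.of_isLittleO ?_
    have h1 : (fun y : E => (φ ‖y‖ - φ 0) • innerCLM E y) =o[𝓝 0] fun y : E => y := by
      rw [Asymptotics.isLittleO_iff]
      intro ε hε
      filter_upwards [Metric.tendsto_nhds.1 hc ε hε] with y hy
      rw [norm_smul, norm_innerCLM_apply]
      rw [dist_zero_right] at hy
      gcongr
    refine (h1.congr_left fun y => ?_).congr_right fun y => ?_
    · ext z
      simp [radialHessian_apply]
      ring
    · simp
  · have hx' : 0 < ‖x‖ := norm_pos_iff.2 hx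
    have h1 := (h.hasDerivAt_fst hx').comp_hasFDerivAt x (hasFDerivAt_norm_of_ne_zero hx)
    refine (h1.smul (innerCLM E).hasFDerivAt).congr_fderiv ?_
    ext y z
    simp [radialHessian_apply]
    field_simp

/-- The rank-one part has norm at most |ψ - φ| despite its singular coefficient, and this tends to 0
at the origin because ψ(0) = φ(0). -/
theorem RadialJet.continuous_hessian (h : RadialJet w φ ψ) :
    Continuous (radialHessian φ ψ : E → E →L[ℝ] E →L[ℝ] ℝ) := by
  unfold radialHessian
  refine (h.continuous_norm_fst.smul continuous_const).add ?_
  rw [continuous_iff_continuousAt]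
  intro x
  rcases eq_or_ne x 0 with rfl | hx
  · have hc : Tendsto (fun y : E => |ψ ‖y‖ - φ ‖y‖|) (𝓝 0) (𝓝 0) := by
      have := ((h.continuous_norm_snd (E := E)).sub h.continuous_norm_fst).abs.tendsto 0
      simpa [h.apply_zero] using this
    have h0 : Tendsto (fun y : E => ((ψ ‖y‖ - φ ‖y‖) / ‖y‖ ^ 2) •
        (innerCLM E y).smulRight (innerCLM E y)) (𝓝 0) (𝓝 0) :=
      squeeze_zero_norm (fun y => norm_rankOne_le _ y) hc
    simpa [ContinuousAt] using h0
  · have hx' : ‖x‖ ^ 2 ≠ 0 := pow_ne_zero 2 (norm_ne_zero_iff.2 hx)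
    have h1 : Continuous fun y : E => (innerCLM E y).smulRight (innerCLM E y) := by
      have := ((ContinuousLinearMap.smulRightL ℝ E (E →L[ℝ] ℝ)).isBoundedBilinearMap).continuous
      exact this.comp ((innerCLM E).continuous.prodMk (innerCLM E).continuous)
    have h2 : ContinuousAt (fun y : E => (ψ ‖y‖ - φ ‖y‖) / ‖y‖ ^ 2) x :=
      ((h.continuous_norm_snd (E := E)).sub h.continuous_norm_fst).continuousAt.div
        (continuous_norm.pow 2).continuousAt hx'
    exact h2.smul h1.continuousAt

theorem RadialJet.contDiff (h : RadialJet w φ ψ) : ContDiff ℝ 2 fun y : E => w ‖y‖ := by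
  have h1 : ContDiff ℝ 1 fun y : E => φ ‖y‖ • innerCLM E y :=
    contDiff_one_iff_hasFDerivAt.2 ⟨_, h.continuous_hessian, h.hasFDerivAt_gradient⟩
  exact (contDiff_succ_iff_hasFDerivAt (n := 1)).2 ⟨_, h1, h.hasFDerivAt⟩

theorem RadialJet.fderiv_eq (h : RadialJet w φ ψ) :
    fderiv ℝ (fun y : E => w ‖y‖) = fun x => φ ‖x‖ • innerCLM E x :=
  funext fun x => (h.hasFDerivAt x).fderiv

theorem RadialJet.fderiv_fderiv_eq (h : RadialJet w φ ψ) :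
    fderiv ℝ (fderiv ℝ (fun y : E => w ‖y‖)) = radialHessian φ ψ := by
  rw [h.fderiv_eq]
  exact funext fun x => (h.hasFDerivAt_gradient x).fderiv

/-- Trace of the Hessian: the identity contributes dim E times φ and the rank-one part ψ - φ, by
Parseval. At the origin the latter is absent, consistently with ψ(0) = φ(0). -/
theorem RadialJet.laplacian_eq (h : RadialJet w φ ψ) [FiniteDimensional ℝ E] (x : E) :
    Laplacian.laplacian (fun y : E => w ‖y‖) x =
      ψ ‖x‖ + ((Module.finrank ℝ E : ℝ) - 1) * φ ‖x‖ := by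
  rw [laplacian_eq_iteratedFDeriv_orthonormalBasis _ (stdOrthonormalBasis ℝ E)]
  simp only [iteratedFDeriv_two_apply, h.fderiv_fderiv_eq, radialHessian_apply]
  simp only [Matrix.cons_val_zero, Matrix.cons_val_one]
  rw [Finset.sum_add_distrib, ← Finset.mul_sum, ← Finset.mul_sum]
  have h1 : ∑ i, inner ℝ x (stdOrthonormalBasis ℝ E i) * inner ℝ x (stdOrthonormalBasis ℝ E i)
      = ‖x‖ ^ 2 := by
    rw [← OrthonormalBasis.sum_sq_norm_inner_left (stdOrthonormalBasis ℝ E) x]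
    refine Finset.sum_congr rfl fun i _ => ?_
    rw [Real.norm_eq_abs, sq_abs, sq]
  have h2 : ∑ i, inner ℝ (stdOrthonormalBasis ℝ E i) (stdOrthonormalBasis ℝ E i)
      = (Module.finrank ℝ E : ℝ) := by
    simp [OrthonormalBasis.norm_eq_one]
  rw [h1, h2]
  rcases eq_or_ne x 0 with rfl | hx
  · simp [h.apply_zero]
    ring
  · have hx' : ‖x‖ ^ 2 ≠ 0 := pow_ne_zero 2 (norm_ne_zero_iff.2 hx)
    rw [div_mul_cancel₀ _ hx']
    ring

/-- The even extension of the profile, its first and its second derivative. -/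
theorem RadialJet.deriv_abs (h : RadialJet w φ ψ) (r : ℝ) :
    deriv (fun s => w |s|) r = r * φ |r| := by
  have h1 := (h.hasFDerivAt r).hasDerivAt.deriv
  simp only [Real.norm_eq_abs] at h1
  rw [h1]
  simp
  ring

theorem RadialJet.deriv_deriv_abs (h : RadialJet w φ ψ) {r : ℝ} (hr : 0 < r) :
    deriv (deriv (fun s => w |s|)) r = ψ r := by
  have h1 : deriv (fun s => w |s|) = fun r => r * φ |r| := funext h.deriv_abs
  rw [h1]
  have h2 : (fun r => r * φ |r|) =ᶠ[𝓝 r] fun r => r * φ r := by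
    filter_upwards [lt_mem_nhds hr] with s hs
    rw [abs_of_pos hs]
  exact ((h.hasDerivAt_deriv r hr).congr_of_eventuallyEq h2).deriv

/-- The distance of the jets of two radial functions. -/
theorem dist_jet_le {w₁ φ₁ ψ₁ w₂ φ₂ ψ₂ : ℝ → ℝ} (h₁ : RadialJet w₁ φ₁ ψ₁)
    (h₂ : RadialJet w₂ φ₂ ψ₂) {u₁ u₂ : C2Function E} (hu₁ : ∀ x, u₁ x = w₁ ‖x‖)
    (hu₂ : ∀ x, u₂ x = w₂ ‖x‖) (x : E) :
    dist (u₁.jet x) (u₂.jet x) ≤ |w₁ ‖x‖ - w₂ ‖x‖| + |‖x‖ * (φ₁ ‖x‖ - φ₂ ‖x‖)| +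
      (2 * |φ₁ ‖x‖ - φ₂ ‖x‖| + |ψ₁ ‖x‖ - ψ₂ ‖x‖|) := by
  have e₁ : u₁.toFun = fun y : E => w₁ ‖y‖ := funext hu₁
  have e₂ : u₂.toFun = fun y : E => w₂ ‖y‖ := funext hu₂
  have hA : dist (u₁ x) (u₂ x) ≤ |w₁ ‖x‖ - w₂ ‖x‖| := by rw [hu₁, hu₂, Real.dist_eq]
  have hB : dist (fderiv ℝ u₁ x) (fderiv ℝ u₂ x) ≤ |‖x‖ * (φ₁ ‖x‖ - φ₂ ‖x‖)| := by
    rw [e₁, e₂, h₁.fderiv_eq, h₂.fderiv_eq, dist_eq_norm, ← sub_smul, norm_smul,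
      norm_innerCLM_apply, abs_mul, abs_norm, mul_comm, Real.norm_eq_abs]
  have hC : dist (fderiv ℝ (fderiv ℝ u₁) x) (fderiv ℝ (fderiv ℝ u₂) x) ≤
      2 * |φ₁ ‖x‖ - φ₂ ‖x‖| + |ψ₁ ‖x‖ - ψ₂ ‖x‖| := by
    rw [e₁, e₂, h₁.fderiv_fderiv_eq, h₂.fderiv_fderiv_eq, dist_eq_norm, radialHessian_sub]
    exact norm_radialHessian_le _ _ x
  have := abs_nonneg (w₁ ‖x‖ - w₂ ‖x‖)
  have := abs_nonneg (‖x‖ * (φ₁ ‖x‖ - φ₂ ‖x‖))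
  have := abs_nonneg (φ₁ ‖x‖ - φ₂ ‖x‖)
  have := abs_nonneg (ψ₁ ‖x‖ - ψ₂ ‖x‖)
  exact max_le (hA.trans (by linarith)) (max_le (hB.trans (by linarith)) (hC.trans (by linarith)))

end Radial

/-! ### Global solutions of the radial initial value problem -/

/-- `w` solves `w'' + (n / r) w' + f(r, w) = 0` for `r > 0` with `w(0) = α`, `w'(0) = 0`, and
`w'(r) = r φ(r)`. -/
structure RadialSolution (n : ℝ) (f : ℝ → ℝ → ℝ) (α : ℝ) (w φ : ℝ → ℝ) : Prop where
  apply_zero : w 0 = α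
  continuous_fst : Continuous φ
  hasDerivAt : ∀ r, HasDerivAt w (r * φ r) r
  hasDerivAt_deriv : ∀ r, 0 < r → HasDerivAt (fun r => r * φ r) (-(n * φ r) - f r (w r)) r
  fst_zero : (n + 1) * φ 0 = -f 0 α

/-- The weighted average `∫₀¹ τ^m g(rτ) dτ`. -/
def radialAverage (m : ℕ) (g : ℝ → ℝ) (r : ℝ) : ℝ :=
  ∫ τ in (0 : ℝ)..1, τ ^ m * g (r * τ)

/-! ### Weighted averages inverting the radial operator. -/

section Average

variable {m : ℕ} {g g₁ g₂ : ℝ → ℝ}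

theorem continuous_radialAverage (hg : Continuous g) : Continuous (radialAverage m g) := by
  unfold radialAverage
  refine intervalIntegral.continuous_parametric_intervalIntegral_of_continuous' ?_ 0 1
  fun_prop

theorem radialAverage_zero : ((m : ℝ) + 1) * radialAverage m g 0 = g 0 := by
  have : radialAverage m g 0 = (∫ τ in (0 : ℝ)..1, τ ^ m) * g 0 := by
    simp [radialAverage]
  rw [this, integral_pow]
  have : (m : ℝ) + 1 ≠ 0 := by positivity
  field_simp
  simp

theorem radialAverage_sub (hg₁ : Continuous g₁) (hg₂ : Continuous g₂) (r : ℝ) :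
    radialAverage m (fun t => g₁ t - g₂ t) r = radialAverage m g₁ r - radialAverage m g₂ r := by
  unfold radialAverage
  rw [← intervalIntegral.integral_sub]
  · simp only [mul_sub]
  · exact Continuous.intervalIntegrable (by fun_prop) _ _
  · exact Continuous.intervalIntegrable (by fun_prop) _ _

/-- Substitution t = rτ. Thus φ = -`radialAverage` integrates (r^m w')' = -r^m g with no singularity
at r = 0. -/
theorem pow_mul_radialAverage (r : ℝ) :
    r ^ (m + 1) * radialAverage m g r = ∫ t in (0 : ℝ)..r, t ^ m * g t := by
  have h := intervalIntegral.mul_integral_comp_mul_left (a := 0) (b := 1)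
    (f := fun t => t ^ m * g t) r
  rw [mul_zero, mul_one] at h
  rw [← h, radialAverage, pow_succ', mul_assoc, ← intervalIntegral.integral_const_mul]
  congr 2
  funext τ
  ring

theorem hasDerivAt_mul_radialAverage (hg : Continuous g) {r : ℝ} (hr : 0 < r) :
    HasDerivAt (fun r => r * radialAverage m g r) (g r - m * radialAverage m g r) r := by
  have hc : Continuous fun t => t ^ m * g t := by fun_prop
  have h1 : HasDerivAt (fun r => ∫ t in (0 : ℝ)..r, t ^ m * g t) (r ^ m * g r) r :=
    intervalIntegral.integral_hasDerivAt_right (hc.intervalIntegrable _ _)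
      (hc.stronglyMeasurableAtFilter _ _) hc.continuousAt
  have h2 := h1.div (hasDerivAt_pow m r) (pow_ne_zero m hr.ne')
  have h3 : (fun r => r * radialAverage m g r) =ᶠ[𝓝 r]
      fun r => (∫ t in (0 : ℝ)..r, t ^ m * g t) / r ^ m := by
    filter_upwards [lt_mem_nhds hr] with s hs
    have : s ≠ 0 := ne_of_gt hs
    rw [← pow_mul_radialAverage, eq_div_iff (pow_ne_zero m this)]
    ring
  refine (h2.congr_of_eventuallyEq h3).congr_deriv ?_
  rw [← pow_mul_radialAverage]
  cases m with
  | zero => simp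
  | succ l =>
    simp only [Nat.add_sub_cancel]
    push_cast
    field_simp
    ring

theorem abs_radialAverage_le {K c : ℝ} (hc : 0 ≤ c)
    (hK : ∀ t, |g t| ≤ K * Real.exp (c * t ^ 2)) (r : ℝ) :
    |radialAverage m g r| ≤ K * Real.exp (c * r ^ 2) := by
  have hK0 : 0 ≤ K := by
    have := (abs_nonneg _).trans (hK 0)
    simpa using this
  have h := intervalIntegral.norm_integral_le_of_norm_le_const (a := 0) (b := 1)
    (f := fun τ => τ ^ m * g (r * τ)) (C := K * Real.exp (c * r ^ 2)) fun τ hτ => ?_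
  · simpa [radialAverage] using h
  · rw [uIoc_of_le zero_le_one] at hτ
    rw [norm_mul, norm_pow, Real.norm_eq_abs, Real.norm_eq_abs, abs_of_pos hτ.1]
    have h1 : τ ^ m ≤ 1 := pow_le_one₀ hτ.1.le hτ.2
    have h2 : (r * τ) ^ 2 ≤ r ^ 2 := by
      rw [mul_pow]
      exact mul_le_of_le_one_right (sq_nonneg r) (pow_le_one₀ hτ.1.le hτ.2)
    calc τ ^ m * |g (r * τ)| ≤ 1 * |g (r * τ)| := by gcongr
      _ ≤ K * Real.exp (c * (r * τ) ^ 2) := by rw [one_mul]; exact hK _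
      _ ≤ K * Real.exp (c * r ^ 2) := by gcongr

/-- Integrating s exp(c s²) gains the factor 1/(2c), which makes the fixed-point map contract in a
Gaussian-weighted norm. -/
theorem abs_integral_mul_radialAverage_le (hg : Continuous g) {K c : ℝ} (hc : 0 < c)
    (hK : ∀ t, |g t| ≤ K * Real.exp (c * t ^ 2)) {r : ℝ} (hr : 0 ≤ r) :
    |∫ s in (0 : ℝ)..r, s * radialAverage m g s| ≤ K / (2 * c) * Real.exp (c * r ^ 2) := by
  have hK0 : 0 ≤ K := by
    have := (abs_nonneg _).trans (hK 0)
    simpa using this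
  have hcont := continuous_radialAverage (m := m) hg
  have h1 : ∫ s in (0 : ℝ)..r, s * (K * Real.exp (c * s ^ 2)) =
      K / (2 * c) * Real.exp (c * r ^ 2) - K / (2 * c) * Real.exp (c * 0 ^ 2) := by
    refine intervalIntegral.integral_eq_sub_of_hasDerivAt
      (f := fun s => K / (2 * c) * Real.exp (c * s ^ 2)) (fun s _ => ?_) ?_
    · have := (((hasDerivAt_pow 2 s).const_mul c).exp).const_mul (K / (2 * c))
      refine this.congr_deriv ?_
      field_simp
      ring
    · exact Continuous.intervalIntegrable (by fun_prop) _ _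
  have h2 : ‖∫ s in (0 : ℝ)..r, s * radialAverage m g s‖ ≤
      ∫ s in (0 : ℝ)..r, s * (K * Real.exp (c * s ^ 2)) := by
    refine intervalIntegral.norm_integral_le_of_norm_le hr
      (MeasureTheory.ae_of_all _ fun s hs => ?_) (Continuous.intervalIntegrable (by fun_prop) _ _)
    rw [norm_mul, Real.norm_eq_abs, Real.norm_eq_abs, abs_of_pos hs.1]
    exact mul_le_mul_of_nonneg_left (abs_radialAverage_le hc.le hK s) hs.1.le
  rw [h1, Real.norm_eq_abs] at h2
  have : 0 ≤ K / (2 * c) * Real.exp (c * 0 ^ 2) := by positivity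
  linarith

end Average

/-- The solution `w` of `w'' + (m / r) w' + g = 0`, `w(0) = α`, `w'(0) = 0`. -/
def radialPotential (m : ℕ) (α : ℝ) (g : ℝ → ℝ) (r : ℝ) : ℝ :=
  α - ∫ s in (0 : ℝ)..r, s * radialAverage m g s

theorem hasDerivAt_radialPotential (m : ℕ) (α : ℝ) {g : ℝ → ℝ} (hg : Continuous g) (r : ℝ) :
    HasDerivAt (radialPotential m α g) (r * -radialAverage m g r) r := by
  have hc : Continuous fun s => s * radialAverage m g s :=
    continuous_id.mul (continuous_radialAverage hg)
  have h1 := intervalIntegral.integral_hasDerivAt_right (hc.intervalIntegrable 0 r)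
    (hc.stronglyMeasurableAtFilter _ _) hc.continuousAt
  exact (h1.const_sub α).congr_deriv (by ring)

/-- Banach's theorem for the bounded continuous unknown y = exp(-c t²) w: the solution map
multiplies distances by at most L/(2c) ≤ 1/2, so the solution is global at once, without
continuation. -/
theorem exists_fixedPoint_radialPotential (m : ℕ) {f : ℝ → ℝ → ℝ}
    (hf : Continuous (Function.uncurry f)) {L : ℝ} (hL : ∀ r z z', |f r z - f r z'| ≤ L * |z - z'|)
    (hf0 : ∀ r, f r 0 = 0) (α : ℝ) :
    ∃ g w : ℝ → ℝ, Continuous g ∧ w = radialPotential m α g ∧ ∀ t, 0 ≤ t → g t = f t (w t) := by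
  have hL0 : 0 ≤ L := by
    have := (abs_nonneg _).trans (hL 0 1 0)
    simpa using this
  -- The added 1 keeps c positive even when L = 0.
  set c : ℝ := L + 1 with hc_def
  have hc : 0 < c := by positivity
  have hexp : ∀ r : ℝ, Real.exp (-(c * r ^ 2)) * Real.exp (c * r ^ 2) = 1 := fun r => by
    rw [← Real.exp_add, neg_add_cancel, Real.exp_zero]
  let g : BoundedContinuousFunction ℝ ℝ → ℝ → ℝ := fun y t => f t (Real.exp (c * t ^ 2) * y t)
  have hg : ∀ y, Continuous (g y) := fun y => by
    have : Continuous fun t : ℝ => (t, Real.exp (c * t ^ 2) * y t) := by fun_prop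
    exact hf.comp this
  have hgd : ∀ y₁ y₂ t, |g y₁ t - g y₂ t| ≤ L * dist y₁ y₂ * Real.exp (c * t ^ 2) := by
    intro y₁ y₂ t
    refine (hL _ _ _).trans ?_
    rw [← mul_sub, abs_mul, Real.abs_exp, mul_assoc, mul_comm (dist y₁ y₂)]
    gcongr
    rw [← Real.dist_eq]
    exact BoundedContinuousFunction.dist_coe_le_dist t
  have hcW : ∀ y, Continuous (radialPotential m α (g y)) := fun y =>
    continuous_iff_continuousAt.2 fun r => (hasDerivAt_radialPotential m α (hg y) r).continuousAt
  have hbd : ∀ y₁ y₂ r, 0 ≤ r →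
      |radialPotential m α (g y₁) r - radialPotential m α (g y₂) r| ≤
        1 / 2 * dist y₁ y₂ * Real.exp (c * r ^ 2) := by
    intro y₁ y₂ r hr
    have h1 : radialPotential m α (g y₁) r - radialPotential m α (g y₂) r =
        -∫ s in (0 : ℝ)..r, s * radialAverage m (fun t => g y₁ t - g y₂ t) s := by
      unfold radialPotential
      simp only [radialAverage_sub (hg y₁) (hg y₂), mul_sub]
      rw [intervalIntegral.integral_sub]
      · ring
      · exact (continuous_id.mul (continuous_radialAverage (hg y₁))).intervalIntegrable _ _
      · exact (continuous_id.mul (continuous_radialAverage (hg y₂))).intervalIntegrable _ _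
    rw [h1, abs_neg]
    refine (abs_integral_mul_radialAverage_le ((hg y₁).sub (hg y₂)) hc (hgd y₁ y₂) hr).trans ?_
    gcongr
    rw [div_le_iff₀ (by positivity)]
    nlinarith [dist_nonneg (x := y₁) (y := y₂)]
  have hg0 : g 0 = fun _ => 0 := by
    funext t
    simp [g, hf0]
  have hW0 : ∀ r, radialPotential m α (g 0) r = α := fun r => by
    rw [hg0]
    simp [radialPotential, radialAverage]
  have hbound : ∀ y r, ‖Real.exp (-(c * r ^ 2)) * radialPotential m α (g y) |r|‖ ≤
      |α| + 1 / 2 * dist y 0 := by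
    intro y r
    have h1 := hbd y 0 |r| (abs_nonneg r)
    rw [hW0, sq_abs] at h1
    have h2 : |radialPotential m α (g y) (|r|)| ≤ |α| + 1 / 2 * dist y 0 * Real.exp (c * r ^ 2) := by
      have := abs_sub_abs_le_abs_sub (radialPotential m α (g y) |r|) α
      linarith
    rw [norm_mul, Real.norm_eq_abs, Real.norm_eq_abs, Real.abs_exp]
    have h3 : Real.exp (-(c * r ^ 2)) ≤ 1 := Real.exp_le_one_iff.2 (by
      have : 0 ≤ c * r ^ 2 := by positivity
      linarith)
    calc Real.exp (-(c * r ^ 2)) * |radialPotential m α (g y) (|r|)|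
        ≤ Real.exp (-(c * r ^ 2)) * (|α| + 1 / 2 * dist y 0 * Real.exp (c * r ^ 2)) := by gcongr
      _ = Real.exp (-(c * r ^ 2)) * |α| +
          1 / 2 * dist y 0 * (Real.exp (-(c * r ^ 2)) * Real.exp (c * r ^ 2)) := by ring
      _ ≤ |α| + 1 / 2 * dist y 0 := by
        rw [hexp, mul_one]
        gcongr
        exact mul_le_of_le_one_left (abs_nonneg α) h3
  -- Evaluation at |r| extends the map to the whole line using estimates valid only for r ≥ 0. Hence
  -- the equation is recovered only for t ≥ 0.
  let S : BoundedContinuousFunction ℝ ℝ → BoundedContinuousFunction ℝ ℝ := fun y =>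
    BoundedContinuousFunction.ofNormedAddCommGroup
      (fun r => Real.exp (-(c * r ^ 2)) * radialPotential m α (g y) |r|)
      (by have := hcW y; fun_prop) _ (hbound y)
  have hS : ∀ y r, S y r = Real.exp (-(c * r ^ 2)) * radialPotential m α (g y) |r| :=
    fun y r => rfl
  have hcontr : ContractingWith (1 / 2) S := by
    refine ⟨by norm_num, LipschitzWith.of_dist_le_mul fun y₁ y₂ => ?_⟩
    rw [BoundedContinuousFunction.dist_le (by positivity)]
    intro r
    rw [Real.dist_eq, hS, hS, ← mul_sub, abs_mul, Real.abs_exp]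
    have h1 := hbd y₁ y₂ |r| (abs_nonneg r)
    rw [sq_abs] at h1
    calc _ ≤ Real.exp (-(c * r ^ 2)) * (1 / 2 * dist y₁ y₂ * Real.exp (c * r ^ 2)) := by gcongr
      _ = 1 / 2 * dist y₁ y₂ * (Real.exp (-(c * r ^ 2)) * Real.exp (c * r ^ 2)) := by ring
      _ = _ := by rw [hexp]; simp
  obtain ⟨y, hy⟩ : ∃ y, S y = y := ⟨_, hcontr.fixedPoint_isFixedPt⟩
  refine ⟨g y, _, hg y, rfl, fun t ht => ?_⟩
  have h1 : Real.exp (c * t ^ 2) * y t = radialPotential m α (g y) t := by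
    conv_lhs => rw [← hy]
    rw [hS, abs_of_nonneg ht, ← mul_assoc, mul_comm (Real.exp (c * t ^ 2)), hexp, one_mul]
  rw [← h1]

/-- The radial initial value problem with a globally Lipschitz nonlinearity is solvable. -/
theorem exists_radialSolution (m : ℕ) {f : ℝ → ℝ → ℝ}
    (hf : Continuous (Function.uncurry f)) {L : ℝ} (hL : ∀ r z z', |f r z - f r z'| ≤ L * |z - z'|)
    (hf0 : ∀ r, f r 0 = 0) (α : ℝ) : ∃ w φ, RadialSolution m f α w φ := by
  obtain ⟨g, w, hg, hw, hgw⟩ := exists_fixedPoint_radialPotential m hf hL hf0 α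
  have h0 : w 0 = α := by simp [hw, radialPotential]
  refine ⟨w, fun r => -radialAverage m g r, h0, (continuous_radialAverage hg).neg, ?_, ?_, ?_⟩
  · intro r
    rw [hw]
    exact hasDerivAt_radialPotential m α hg r
  · intro r hr
    have h1 := (hasDerivAt_mul_radialAverage (m := m) hg hr).neg
    rw [← hgw r hr.le]
    refine (h1.congr_of_eventuallyEq (Eventually.of_forall fun s => ?_)).congr_deriv (by ring)
    simp
  · have := radialAverage_zero (m := m) (g := g)
    rw [mul_neg, this, hgw 0 le_rfl, h0]

/-! ### The nonlinearity and its primitive -/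

/-- The nonlinearity `k(r)² z + Q(r) |z|^(p-2) z`. -/
def nonlinearity (p : ℝ) (k Q : ℝ → ℝ) (r z : ℝ) : ℝ :=
  k r ^ 2 * z + Q r * |z| ^ (p - 2) * z

/-- The range of amplitudes in which the limit nonlinearity is strictly coercive. -/
def Admissible (p kinf Qinf a : ℝ) : Prop :=
  0 ≤ a ∧ max (-Qinf) 0 * a ^ (p - 2) < kinf ^ 2

theorem hasDerivAt_abs_rpow_mul {q : ℝ} (hq : 0 < q) (z : ℝ) :
    HasDerivAt (fun z : ℝ => |z| ^ q * z) ((q + 1) * |z| ^ q) z := by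
  have hne : ∀ y : ℝ, y ≠ 0 → HasDerivAt (fun z : ℝ => |z| ^ q * z) ((q + 1) * |y| ^ q) y := by
    intro y hy
    have h1 := (((hasDerivAt_abs hy).rpow_const (p := q) (Or.inl (abs_ne_zero.2 hy)))).mul
      (hasDerivAt_id y)
    refine h1.congr_deriv ?_
    have h2 : |y| ^ q = |y| ^ (q - 1) * |y| := by
      rw [← Real.rpow_add_one (abs_ne_zero.2 hy)]
      congr 1
      ring
    rcases lt_or_gt_of_ne hy with h | h
    · rw [h2, abs_of_neg h]
      simp [h]
      ring
    · rw [h2, abs_of_pos h]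
      simp [h]
      ring
  rcases eq_or_ne z 0 with rfl | hz
  · have hc : Continuous fun z : ℝ => |z| ^ q :=
      continuous_abs.rpow_const fun _ => Or.inr hq.le
    -- The derivative at 0 is the limit of the derivatives at nearby points.
    exact hasDerivAt_of_hasDerivAt_of_ne hne (hc.mul continuous_id).continuousAt
      (continuous_const.mul hc).continuousAt
  · exact hne z hz

theorem abs_rpow_mul_sub_le {q b x y : ℝ} (hq : 0 < q) (hx : |x| ≤ b) (hy : |y| ≤ b) :
    |(|x| ^ q * x) - |y| ^ q * y| ≤ (q + 1) * b ^ q * |x - y| := by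
  have h := (convex_Icc (-b) b).norm_image_sub_le_of_norm_hasDerivWithin_le
    (f := fun z : ℝ => |z| ^ q * z) (f' := fun z => (q + 1) * |z| ^ q) (C := (q + 1) * b ^ q)
    (fun z _ => (hasDerivAt_abs_rpow_mul hq z).hasDerivWithinAt) (fun z hz => ?_)
    (abs_le.1 hy) (abs_le.1 hx)
  · exact h
  · rw [norm_mul, Real.norm_eq_abs, Real.norm_eq_abs, abs_of_pos (by linarith),
      Real.abs_rpow_of_nonneg (abs_nonneg z), abs_abs]
    have := abs_le.2 hz
    gcongr

/-! ### Coercivity and monotonicity of the primitive. -/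

section Algebra

variable {p κ q z : ℝ}

theorem abs_rpow_eq_sq_mul (hp : 2 < p) (z : ℝ) : |z| ^ p = z ^ 2 * |z| ^ (p - 2) := by
  rcases eq_or_ne z 0 with rfl | hz
  · rw [abs_zero, Real.zero_rpow (by linarith)]
    simp
  · have : 0 < |z| := abs_pos.2 hz
    rw [← sq_abs, ← Real.rpow_natCast, ← Real.rpow_add this]
    congr 1
    push_cast
    ring

theorem primitive_eq_sq_mul (hp : 2 < p) (κ q z : ℝ) :
    primitive p κ q z = z ^ 2 * (κ ^ 2 / 2 + q / p * |z| ^ (p - 2)) := by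
  rw [primitive, abs_rpow_eq_sq_mul hp]
  ring

@[simp]
theorem primitive_abs (p κ q z : ℝ) : primitive p κ q |z| = primitive p κ q z := by
  simp [primitive]

theorem primitive_zero (hp : 2 < p) (κ q : ℝ) : primitive p κ q 0 = 0 := by
  rw [primitive_eq_sq_mul hp]
  ring

theorem hasDerivAt_primitive (hp : 2 < p) (κ q z : ℝ) :
    HasDerivAt (primitive p κ q) (κ ^ 2 * z + q * |z| ^ (p - 2) * z) z := by
  have h1 := ((hasDerivAt_pow 2 z).const_mul (κ ^ 2 / 2)).add
    ((hasDerivAt_abs_rpow z (by linarith : 1 < p)).const_mul (q / p))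
  refine h1.congr_deriv ?_
  have : p ≠ 0 := by linarith
  field_simp
  push_cast
  ring

theorem continuous_primitive (hp : 2 < p) (κ q : ℝ) : Continuous (primitive p κ q) :=
  continuous_iff_continuousAt.2 fun z => (hasDerivAt_primitive hp κ q z).continuousAt

variable {kinf Qinf a : ℝ}

/-- The coercivity constant at amplitude `a`. -/
def coercivity (p kinf Qinf a : ℝ) : ℝ := kinf ^ 2 - max (-Qinf) 0 * a ^ (p - 2)

theorem Admissible.coercivity_pos (ha : Admissible p kinf Qinf a) :
    0 < coercivity p kinf Qinf a := sub_pos.2 ha.2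

theorem neg_le_mul_abs_rpow (hp : 2 < p) (hq : Qinf ≤ q) (hz : |z| ≤ a) :
    -(max (-Qinf) 0 * a ^ (p - 2)) ≤ q * |z| ^ (p - 2) := by
  have h1 : |z| ^ (p - 2) ≤ a ^ (p - 2) := by gcongr
  have h2 : 0 ≤ |z| ^ (p - 2) := by positivity
  have h3 : -q ≤ max (-Qinf) 0 := le_max_of_le_left (by linarith)
  have h4 : 0 ≤ max (-Qinf) 0 := le_max_right _ _
  nlinarith

theorem coercivity_le (hp : 2 < p) (hkinf : 0 < kinf)
    (hκ : kinf ≤ κ) (hq : Qinf ≤ q) (hz : |z| ≤ a) :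
    coercivity p kinf Qinf a ≤ κ ^ 2 + q * |z| ^ (p - 2) := by
  have := neg_le_mul_abs_rpow hp hq hz
  have : kinf ^ 2 ≤ κ ^ 2 := by gcongr
  unfold coercivity
  linarith

/-- Since p > 2, the possibly negative power term is divided by more than 2, so at least half of the
coercivity survives integration. -/
theorem coercivity_mul_sq_le_primitive (hp : 2 < p) (hkinf : 0 < kinf) (hκ : kinf ≤ κ)
    (hq : Qinf ≤ q) (hz : |z| ≤ a) :
    coercivity p kinf Qinf a / 2 * z ^ 2 ≤ primitive p κ q z := by
  rw [primitive_eq_sq_mul hp, mul_comm]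
  refine mul_le_mul_of_nonneg_left ?_ (sq_nonneg z)
  have h1 := neg_le_mul_abs_rpow hp hq hz
  have h2 : kinf ^ 2 ≤ κ ^ 2 := by gcongr
  have h3 : 0 ≤ max (-Qinf) 0 * a ^ (p - 2) :=
    mul_nonneg (le_max_right _ _) (Real.rpow_nonneg ((abs_nonneg z).trans hz) _)
  have h4 : -(max (-Qinf) 0 * a ^ (p - 2)) / 2 ≤ q / p * |z| ^ (p - 2) := by
    have h5 : q / p * |z| ^ (p - 2) = (q * |z| ^ (p - 2)) / p := by ring
    rw [h5]
    refine le_trans ?_ (div_le_div_of_nonneg_right h1 (by linarith : 0 ≤ p))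
    rw [neg_div, neg_div, neg_le_neg_iff]
    gcongr
  unfold coercivity
  linarith

theorem primitive_nonneg (hp : 2 < p) (hkinf : 0 < kinf) (ha : Admissible p kinf Qinf a)
    (hκ : kinf ≤ κ) (hq : Qinf ≤ q) (hz : |z| ≤ a) : 0 ≤ primitive p κ q z :=
  (mul_nonneg (half_pos ha.coercivity_pos).le (sq_nonneg z)).trans
    (coercivity_mul_sq_le_primitive hp hkinf hκ hq hz)

theorem primitive_mono_coeff (hp : 2 < p) (hkinf : 0 < kinf) (hκ : kinf ≤ κ) (hq : Qinf ≤ q) :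
    primitive p kinf Qinf z ≤ primitive p κ q z := by
  have : 0 < p := by linarith
  unfold primitive
  gcongr

/-- The derivative is (κ² + q|z|^(p-2)) z, whose bracket is positive up to an admissible a. This is
what turns energy inequalities into amplitude inequalities. -/
theorem strictMonoOn_primitive (hp : 2 < p) (hkinf : 0 < kinf) (ha : Admissible p kinf Qinf a)
    (hκ : kinf ≤ κ) (hq : Qinf ≤ q) : StrictMonoOn (primitive p κ q) (Icc 0 a) := by
  refine strictMonoOn_of_deriv_pos (convex_Icc 0 a) (continuous_primitive hp κ q).continuousOn
    fun z hz => ?_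
  rw [interior_Icc] at hz
  rw [(hasDerivAt_primitive hp κ q z).deriv, ← add_mul]
  refine mul_pos (ha.coercivity_pos.trans_le (coercivity_le hp hkinf hκ hq ?_)) hz.1
  rw [abs_of_pos hz.1]
  exact hz.2.le

theorem abs_le_of_primitive_le (hp : 2 < p) (hkinf : 0 < kinf) {b x : ℝ}
    (hb : Admissible p kinf Qinf b) (hκ : kinf ≤ κ) (hq : Qinf ≤ q) (hx : |x| ≤ b) (ha0 : 0 ≤ a)
    (hab : a ≤ b) (h : primitive p κ q x ≤ primitive p κ q a) : |x| ≤ a := by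
  rw [← primitive_abs p κ q x] at h
  exact ((strictMonoOn_primitive hp hkinf hb hκ hq).le_iff_le ⟨abs_nonneg x, hx⟩ ⟨ha0, hab⟩).1 h

theorem Admissible.mono (hp : 2 < p) {b : ℝ} (hb : Admissible p kinf Qinf b) (ha0 : 0 ≤ a)
    (hab : a ≤ b) : Admissible p kinf Qinf a := by
  refine ⟨ha0, lt_of_le_of_lt ?_ hb.2⟩
  have : 0 ≤ max (-Qinf) 0 := le_max_right _ _
  gcongr

end Algebra

/-! ### The energy -/

/-- Nonincreasing differentiable coefficients on `[0, ∞)` bounded from below. -/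
structure DecreasingCoeffs (k Q : ℝ → ℝ) (kinf Qinf : ℝ) : Prop where
  continuousOn_left : ContinuousOn k (Ici 0)
  continuousOn_right : ContinuousOn Q (Ici 0)
  hasDerivAt_left : ∀ r, 0 < r → HasDerivAt k (deriv k r) r
  hasDerivAt_right : ∀ r, 0 < r → HasDerivAt Q (deriv Q r) r
  deriv_left_nonpos : ∀ r, 0 < r → deriv k r ≤ 0
  deriv_right_nonpos : ∀ r, 0 < r → deriv Q r ≤ 0
  left_le : ∀ r, 0 ≤ r → k r ≤ k 0
  right_le : ∀ r, 0 ≤ r → Q r ≤ Q 0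
  le_left : ∀ r, 0 ≤ r → kinf ≤ k r
  le_right : ∀ r, 0 ≤ r → Qinf ≤ Q r
  pos : 0 < kinf

theorem hasDerivAt_of_contDiffOn_Ici {g : ℝ → ℝ} (hg : ContDiffOn ℝ 1 g (Ici 0)) {r : ℝ}
    (hr : 0 < r) : HasDerivAt g (deriv g r) r :=
  (((hg.differentiableOn one_ne_zero) r hr.le).differentiableAt (Ici_mem_nhds hr)).hasDerivAt

theorem deriv_nonpos_of_antitoneOn_Ici {g : ℝ → ℝ} (hg : AntitoneOn g (Ici 0)) {r : ℝ}
    (hr : 0 < r) : deriv g r ≤ 0 := by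
  rw [← derivWithin_of_mem_nhds (Ici_mem_nhds hr)]
  exact hg.derivWithin_nonpos

theorem le_of_antitoneOn_Ici_of_tendsto {g : ℝ → ℝ} {l : ℝ} (hg : AntitoneOn g (Ici 0))
    (hl : Tendsto g atTop (𝓝 l)) {r : ℝ} (hr : 0 ≤ r) : l ≤ g r := by
  refine le_of_tendsto hl ?_
  filter_upwards [eventually_ge_atTop r] with s hs
  exact hg hr (hr.trans hs : (0 : ℝ) ≤ s) hs

theorem DecreasingCoeffs.of_contDiffOn {k Q : ℝ → ℝ} {kinf Qinf : ℝ}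
    (hk : ContDiffOn ℝ 1 k (Set.Ici 0)) (hQ : ContDiffOn ℝ 1 Q (Set.Ici 0))
    (hk_anti : AntitoneOn k (Set.Ici 0)) (hQ_anti : AntitoneOn Q (Set.Ici 0))
    (hk_lim : Tendsto k atTop (𝓝 kinf)) (hQ_lim : Tendsto Q atTop (𝓝 Qinf))
    (hkinf : 0 < kinf) : DecreasingCoeffs k Q kinf Qinf where
  continuousOn_left := hk.continuousOn
  continuousOn_right := hQ.continuousOn
  hasDerivAt_left _ := hasDerivAt_of_contDiffOn_Ici hk
  hasDerivAt_right _ := hasDerivAt_of_contDiffOn_Ici hQ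
  deriv_left_nonpos _ := deriv_nonpos_of_antitoneOn_Ici hk_anti
  deriv_right_nonpos _ := deriv_nonpos_of_antitoneOn_Ici hQ_anti
  left_le _ hr := hk_anti self_mem_Ici hr hr
  right_le _ hr := hQ_anti self_mem_Ici hr hr
  le_left _ := le_of_antitoneOn_Ici_of_tendsto hk_anti hk_lim
  le_right _ := le_of_antitoneOn_Ici_of_tendsto hQ_anti hQ_lim
  pos := hkinf

/-- The energy `w'² / 2 + G(r, w)`. -/
def energy (p : ℝ) (k Q w φ : ℝ → ℝ) (r : ℝ) : ℝ :=
  (r * φ r) ^ 2 / 2 + primitive p (k r) (Q r) (w r)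

/-- The derivative of the primitive with respect to the radial variable. -/
def drift (p : ℝ) (k Q : ℝ → ℝ) (r z : ℝ) : ℝ :=
  k r * deriv k r * z ^ 2 + deriv Q r / p * |z| ^ p

section Energy

variable {p n α kinf Qinf b r : ℝ} {k Q w φ : ℝ → ℝ} {f : ℝ → ℝ → ℝ}

theorem DecreasingCoeffs.abs_right_le (hc : DecreasingCoeffs k Q kinf Qinf) (hr : 0 ≤ r) :
    |Q r| ≤ |Q 0| + |Qinf| := by
  have h1 := hc.right_le r hr
  have h2 := hc.le_right r hr
  rw [abs_le]
  constructor
  · linarith [neg_abs_le Qinf, abs_nonneg (Q 0)]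
  · linarith [le_abs_self (Q 0), abs_nonneg Qinf]

theorem DecreasingCoeffs.drift_nonpos (hc : DecreasingCoeffs k Q kinf Qinf) (hp : 2 < p)
    (hr : 0 < r) (z : ℝ) : drift p k Q r z ≤ 0 := by
  have h1 := hc.deriv_left_nonpos r hr
  have h2 := hc.deriv_right_nonpos r hr
  have h3 : 0 ≤ k r := hc.pos.le.trans (hc.le_left r hr.le)
  have h4 : k r * deriv k r * z ^ 2 ≤ 0 :=
    mul_nonpos_of_nonpos_of_nonneg (mul_nonpos_of_nonneg_of_nonpos h3 h1) (sq_nonneg z)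
  have h5 : deriv Q r / p * |z| ^ p ≤ 0 :=
    mul_nonpos_of_nonpos_of_nonneg (div_nonpos_of_nonpos_of_nonneg h2 (by linarith))
      (by positivity)
  unfold drift
  linarith

theorem DecreasingCoeffs.hasDerivAt_primitive (hc : DecreasingCoeffs k Q kinf Qinf) (hp : 2 < p)
    (hr : 0 < r) {v : ℝ} (hw : HasDerivAt w v r) :
    HasDerivAt (fun r => primitive p (k r) (Q r) (w r))
      (drift p k Q r (w r) + nonlinearity p k Q r (w r) * v) r := by
  have h1 := (hasDerivAt_abs_rpow (w r) (by linarith : 1 < p)).comp r hw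
  have h2 := ((((hc.hasDerivAt_left r hr).pow 2).div_const 2).mul (hw.pow 2)).add
    (((hc.hasDerivAt_right r hr).div_const p).mul h1)
  refine h2.congr_deriv ?_
  have : p ≠ 0 := by linarith
  simp only [drift, nonlinearity, Function.comp, Pi.pow_apply]
  field_simp
  push_cast
  ring

theorem DecreasingCoeffs.hasDerivAt_energy (hc : DecreasingCoeffs k Q kinf Qinf) (hp : 2 < p)
    (hr : 0 < r) (hw : HasDerivAt w (r * φ r) r)
    (hv : HasDerivAt (fun r => r * φ r) (-(n * φ r) - nonlinearity p k Q r (w r)) r) :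
    HasDerivAt (energy p k Q w φ) (-(n * r * φ r ^ 2) + drift p k Q r (w r)) r := by
  have h1 := ((hv.pow 2).div_const 2).add (hc.hasDerivAt_primitive hp hr hw)
  refine h1.congr_deriv ?_
  push_cast
  ring

theorem DecreasingCoeffs.continuousOn_energy (hc : DecreasingCoeffs k Q kinf Qinf) (hp : 2 < p)
    (hw : Continuous w) (hφ : Continuous φ) : ContinuousOn (energy p k Q w φ) (Ici 0) := by
  have h1 := hc.continuousOn_left
  have h2 := hc.continuousOn_right
  have h3 : Continuous fun r => |w r| ^ p := hw.abs.rpow_const fun _ => Or.inr (by linarith)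
  exact (((continuous_id.mul hφ).pow 2).div_const 2).continuousOn.add
    ((((h1.pow 2).div_const 2).mul (hw.pow 2).continuousOn).add
      ((h2.div_const p).mul h3.continuousOn))

theorem RadialSolution.continuous (h : RadialSolution n f α w φ) : Continuous w :=
  continuous_iff_continuousAt.2 fun r => (h.hasDerivAt r).continuousAt

theorem RadialSolution.energy_zero (h : RadialSolution n f α w φ) :
    energy p k Q w φ 0 = primitive p (k 0) (Q 0) α := by
  simp [energy, h.apply_zero]

/-- E' = -n w'²/r + `drift` ≤ 0. The true equation is required only along w on (0, R), so the lemma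
covers a truncated problem before the truncation is known to be inactive. -/
theorem RadialSolution.energy_antitoneOn_Icc (hc : DecreasingCoeffs k Q kinf Qinf) (hp : 2 < p)
    (hn : 0 ≤ n) (h : RadialSolution n f α w φ) {R : ℝ}
    (hf : ∀ r, 0 < r → r < R → f r (w r) = nonlinearity p k Q r (w r)) :
    AntitoneOn (energy p k Q w φ) (Icc 0 R) := by
  refine antitoneOn_of_hasDerivWithinAt_nonpos (convex_Icc 0 R)
    (f' := fun r => -(n * r * φ r ^ 2) + drift p k Q r (w r))
    ((hc.continuousOn_energy hp h.continuous h.continuous_fst).mono Icc_subset_Ici_self)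
    (fun r hr => ?_) (fun r hr => ?_) <;> rw [interior_Icc] at hr
  · have h1 := h.hasDerivAt_deriv r hr.1
    rw [hf r hr.1 hr.2] at h1
    exact (hc.hasDerivAt_energy hp hr.1 (h.hasDerivAt r) h1).hasDerivWithinAt
  · have h1 := hc.drift_nonpos hp hr.1 (w r)
    have h2 : 0 ≤ n * r * φ r ^ 2 := mul_nonneg (mul_nonneg hn hr.1.le) (sq_nonneg _)
    linarith

theorem RadialSolution.energy_antitoneOn (hc : DecreasingCoeffs k Q kinf Qinf) (hp : 2 < p)
    (hn : 0 ≤ n) (h : RadialSolution n (nonlinearity p k Q) α w φ) :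
    AntitoneOn (energy p k Q w φ) (Ici 0) := fun _ hx y hy hxy =>
  h.energy_antitoneOn_Icc hc hp hn (R := y) (fun _ _ _ => rfl) ⟨hx, hxy⟩ ⟨hy, le_rfl⟩ hxy

theorem primitive_le_energy (p : ℝ) (k Q w φ : ℝ → ℝ) (r : ℝ) :
    primitive p (k r) (Q r) (w r) ≤ energy p k Q w φ r :=
  le_add_of_nonneg_left (by positivity)

theorem DecreasingCoeffs.abs_lt_of_primitive_lt (hc : DecreasingCoeffs k Q kinf Qinf)
    (hp : 2 < p) (hα : |α| ≤ b)
    (hlt : primitive p (k 0) (Q 0) α < primitive p kinf Qinf b) : |α| < b := by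
  refine lt_of_le_of_ne hα fun heq => ?_
  rw [← heq, primitive_abs] at hlt
  exact absurd (primitive_mono_coeff hp hc.pos (hc.le_left 0 le_rfl) (hc.le_right 0 le_rfl))
    hlt.not_ge

/-- Solutions starting below the energy level of `b` stay below `b`. -/
theorem RadialSolution.abs_lt_of_primitive_lt (hc : DecreasingCoeffs k Q kinf Qinf) (hp : 2 < p)
    (hn : 0 ≤ n) (hα : |α| ≤ b)
    (hlt : primitive p (k 0) (Q 0) α < primitive p kinf Qinf b)
    (h : RadialSolution n f α w φ)
    (hf : ∀ r z, 0 < r → |z| ≤ b → f r z = nonlinearity p k Q r z) (hr : 0 ≤ r) :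
    |w r| < b := by
  by_contra! hcon
  have hwc : Continuous fun s => |w s| := h.continuous.abs
  have hα' : |w 0| < b := by
    rw [h.apply_zero]
    exact hc.abs_lt_of_primitive_lt hp hα hlt
  -- At the first time s with |w| = b the energy is at least G_∞(b), above its initial value,
  -- although it has only decreased up to s.
  obtain ⟨s, ⟨⟨hs0, hsr⟩, hsb⟩, hmin⟩ : ∃ s, IsLeast (Icc 0 r ∩ {s | b ≤ |w s|}) s :=
    (isCompact_Icc.inter_right (isClosed_le continuous_const hwc)).exists_isLeast
      ⟨r, ⟨hr, le_rfl⟩, hcon⟩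
  have hbelow : ∀ t, 0 < t → t < s → |w t| ≤ b := by
    intro t ht hts
    by_contra! hbt
    exact absurd (hmin ⟨⟨ht.le, hts.le.trans hsr⟩, hbt.le⟩) (not_le.2 hts)
  obtain ⟨t, ht, htb⟩ := intermediate_value_Icc hs0 hwc.continuousOn ⟨hα'.le, hsb⟩
  have hts : t = s := le_antisymm ht.2 (hmin ⟨⟨ht.1, ht.2.trans hsr⟩, htb.ge⟩)
  replace htb : |w s| = b := hts ▸ htb
  have hE := h.energy_antitoneOn_Icc hc hp hn (R := s)
    (fun t ht hts => hf t _ ht (hbelow t ht hts)) ⟨le_rfl, hs0⟩ ⟨hs0, le_rfl⟩ hs0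
  rw [h.energy_zero] at hE
  have h1 := primitive_le_energy p k Q w φ s
  have h2 : primitive p kinf Qinf (w s) ≤ primitive p (k s) (Q s) (w s) :=
    primitive_mono_coeff hp hc.pos (hc.le_left s hs0) (hc.le_right s hs0)
  rw [← primitive_abs p kinf Qinf (w s), htb] at h2
  linarith

/-- The bound of the amplitude by the initial energy. -/
theorem RadialSolution.abs_le_of_primitive_eq (hc : DecreasingCoeffs k Q kinf Qinf) (hp : 2 < p)
    (hn : 0 ≤ n) (hb : Admissible p kinf Qinf b)
    (h : RadialSolution n (nonlinearity p k Q) α w φ) (hwb : ∀ r, 0 ≤ r → |w r| ≤ b) {a : ℝ}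
    (ha0 : 0 ≤ a) (hab : a ≤ b)
    (ha : primitive p kinf Qinf a = primitive p (k 0) (Q 0) α) (hr : 0 ≤ r) : |w r| ≤ a := by
  refine abs_le_of_primitive_le hp hc.pos hb le_rfl le_rfl (hwb r hr) ha0 hab ?_
  have hE := h.energy_antitoneOn hc hp hn (self_mem_Ici) hr hr
  rw [h.energy_zero] at hE
  rw [ha]
  exact ((primitive_mono_coeff hp hc.pos (hc.le_left r hr) (hc.le_right r hr)).trans
    (primitive_le_energy p k Q w φ r)).trans hE

theorem RadialSolution.abs_deriv_le (hc : DecreasingCoeffs k Q kinf Qinf) (hp : 2 < p)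
    (hn : 0 ≤ n) (hb : Admissible p kinf Qinf b)
    (h : RadialSolution n (nonlinearity p k Q) α w φ) (hwb : ∀ r, 0 ≤ r → |w r| ≤ b)
    (hr : 0 ≤ r) : |r * φ r| ≤ √(2 * primitive p (k 0) (Q 0) α) := by
  have hE := h.energy_antitoneOn hc hp hn (self_mem_Ici) hr hr
  rw [h.energy_zero] at hE
  have h1 := primitive_nonneg hp hc.pos hb (hc.le_left r hr) (hc.le_right r hr) (hwb r hr)
  refine Real.abs_le_sqrt ?_
  unfold energy at hE
  linarith

/-- The Lipschitz constant of the nonlinearity on `[-b, b]`. -/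
def lipschitzBound (p : ℝ) (k Q : ℝ → ℝ) (Qinf b : ℝ) : ℝ :=
  k 0 ^ 2 + (|Q 0| + |Qinf|) * ((p - 1) * b ^ (p - 2))

theorem DecreasingCoeffs.abs_nonlinearity_sub_le (hc : DecreasingCoeffs k Q kinf Qinf)
    (hp : 2 < p) {x y : ℝ} (hr : 0 ≤ r) (hx : |x| ≤ b) (hy : |y| ≤ b) :
    |nonlinearity p k Q r x - nonlinearity p k Q r y| ≤ lipschitzBound p k Q Qinf b * |x - y| := by
  have h1 := abs_rpow_mul_sub_le (by linarith : 0 < p - 2) hx hy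
  have h2 := hc.abs_right_le hr
  have h3 : k r ^ 2 ≤ k 0 ^ 2 := by
    have := hc.left_le r hr
    have : 0 ≤ k r := hc.pos.le.trans (hc.le_left r hr)
    gcongr
  have h4 : nonlinearity p k Q r x - nonlinearity p k Q r y =
      k r ^ 2 * (x - y) + Q r * (|x| ^ (p - 2) * x - |y| ^ (p - 2) * y) := by
    unfold nonlinearity
    ring
  have h5 : p - 2 + 1 = p - 1 := by ring
  rw [h5] at h1
  calc _ ≤ k r ^ 2 * |x - y| + |Q r| * |(|x| ^ (p - 2) * x) - |y| ^ (p - 2) * y| := by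
        rw [h4, ← abs_mul, ← abs_of_nonneg (sq_nonneg (k r)), ← abs_mul,
          abs_of_nonneg (sq_nonneg (k r))]
        exact abs_add_le _ _
    _ ≤ k 0 ^ 2 * |x - y| + (|Q 0| + |Qinf|) * ((p - 1) * b ^ (p - 2) * |x - y|) := by gcongr
    _ = _ := by unfold lipschitzBound; ring

theorem nonlinearity_zero (p : ℝ) (k Q : ℝ → ℝ) (r : ℝ) : nonlinearity p k Q r 0 = 0 := by
  simp [nonlinearity]

/-- The projection onto `[-b, b]`. -/
def clamp (b z : ℝ) : ℝ := max (-b) (min z b)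

theorem abs_clamp_le (hb : 0 ≤ b) (z : ℝ) : |clamp b z| ≤ b :=
  abs_le.2 ⟨le_max_left _ _, max_le (by linarith) (min_le_right _ _)⟩

theorem clamp_of_abs_le {z : ℝ} (hz : |z| ≤ b) : clamp b z = z := by
  rw [abs_le] at hz
  rw [clamp, min_eq_left hz.2, max_eq_right hz.1]

theorem abs_clamp_sub_le (x y : ℝ) : |clamp b x - clamp b y| ≤ |x - y| :=
  by
  unfold clamp
  have h1 := abs_max_sub_max_le_max (-b) (min x b) (-b) (min y b)
  have h2 := abs_min_sub_min_le_max x b y b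
  rw [sub_self, abs_zero, max_eq_right (abs_nonneg (min x b - min y b))] at h1
  rw [sub_self, abs_zero, max_eq_left (abs_nonneg (x - y))] at h2
  exact h1.trans h2

/-- Clamping z to [-b, b] makes the nonlinearity globally Lipschitz, and the even extension of k and
Q makes it continuous on the whole line. The energy barrier keeps |w| < b for r ≥ 0, where neither
change is visible. -/
theorem exists_radialSolution_nonlinearity (hc : DecreasingCoeffs k Q kinf Qinf) (hp : 2 < p)
    (m : ℕ) (hb : Admissible p kinf Qinf b) (hα : |α| ≤ b)
    (hlt : primitive p (k 0) (Q 0) α < primitive p kinf Qinf b) :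
    ∃ w φ, RadialSolution m (nonlinearity p k Q) α w φ ∧ ∀ r, 0 ≤ r → |w r| ≤ b := by
  have hck : Continuous fun r => k |r| :=
    hc.continuousOn_left.comp_continuous continuous_abs fun r => abs_nonneg r
  have hcQ : Continuous fun r => Q |r| :=
    hc.continuousOn_right.comp_continuous continuous_abs fun r => abs_nonneg r
  have hcl : Continuous (clamp b) := by unfold clamp; fun_prop
  have hcl' : Continuous fun z => |clamp b z| ^ (p - 2) :=
    hcl.abs.rpow_const fun _ => Or.inr (by linarith)
  obtain ⟨w, φ, h⟩ := exists_radialSolution m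
    (f := fun r z => nonlinearity p k Q |r| (clamp b z)) (L := lipschitzBound p k Q Qinf b)
    ((((hck.comp continuous_fst).pow 2).mul (hcl.comp continuous_snd)).add
      (((hcQ.comp continuous_fst).mul (hcl'.comp continuous_snd)).mul (hcl.comp continuous_snd)))
    (fun r x y => (hc.abs_nonlinearity_sub_le hp (abs_nonneg r) (abs_clamp_le hb.1 x)
      (abs_clamp_le hb.1 y)).trans (by
        refine mul_le_mul_of_nonneg_left (abs_clamp_sub_le x y) ?_
        have : 0 ≤ p - 1 := by linarith
        have := hb.1
        unfold lipschitzBound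
        positivity))
    (fun r => by
      rw [clamp_of_abs_le (by simpa using hb.1), nonlinearity_zero]) α
  have hf : ∀ r z, 0 ≤ r → |z| ≤ b →
      nonlinearity p k Q |r| (clamp b z) = nonlinearity p k Q r z := fun r z hr hz => by
    rw [abs_of_nonneg hr, clamp_of_abs_le hz]
  have hwb : ∀ r, 0 ≤ r → |w r| < b := fun r hr =>
    h.abs_lt_of_primitive_lt hc hp (Nat.cast_nonneg m) hα hlt
      (fun r z hr hz => hf r z hr.le hz) hr
  refine ⟨w, φ, ⟨h.apply_zero, h.continuous_fst, h.hasDerivAt, fun r hr => ?_, ?_⟩,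
    fun r hr => (hwb r hr).le⟩
  · have := h.hasDerivAt_deriv r hr
    rwa [hf r _ hr.le (hwb r hr.le).le] at this
  · rw [h.fst_zero, hf 0 α le_rfl hα]

end Energy

/-! ### Decay at infinity -/

section Decay

variable {p n α kinf Qinf b r : ℝ} {k Q w φ : ℝ → ℝ}

/-- The second derivative of the profile. -/
def profileSecond (p n : ℝ) (k Q w φ : ℝ → ℝ) (r : ℝ) : ℝ :=
  -(n * φ r) - nonlinearity p k Q r (w r)

theorem RadialSolution.radialJet (hc : DecreasingCoeffs k Q kinf Qinf) (hp : 2 < p)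
    (h : RadialSolution n (nonlinearity p k Q) α w φ) :
    RadialJet w φ (profileSecond p n k Q w φ) where
  hasDerivAt r _ := h.hasDerivAt r
  hasDerivAt_deriv := h.hasDerivAt_deriv
  continuousOn_fst := h.continuous_fst.continuousOn
  continuousOn_snd := by
    have h1 := hc.continuousOn_left
    have h2 := hc.continuousOn_right
    have h3 : Continuous fun r => |w r| ^ (p - 2) :=
      h.continuous.abs.rpow_const fun _ => Or.inr (by linarith)
    have h4 := h.continuous.continuousOn (s := Ici 0)
    exact (h.continuous_fst.continuousOn.const_smul n).neg.sub
      (((h1.pow 2).mul h4).add ((h2.mul h3.continuousOn).mul h4))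
  apply_zero := by
    have := h.fst_zero
    rw [profileSecond, h.apply_zero]
    linarith

/-- A lower bound for the energy in terms of `w² + w'²`. -/
def energyLower (p kinf Qinf b : ℝ) : ℝ := min 1 (coercivity p kinf Qinf b) / 2

/-- An upper bound for the energy in terms of `w² + w'²`. -/
def energyUpper (p : ℝ) (k Q : ℝ → ℝ) (Qinf b : ℝ) : ℝ :=
  1 + k 0 ^ 2 + (|Q 0| + |Qinf|) * b ^ (p - 2)

theorem Admissible.energyLower_pos (hb : Admissible p kinf Qinf b) :
    0 < energyLower p kinf Qinf b :=
  half_pos (lt_min one_pos hb.coercivity_pos)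

theorem Admissible.energyUpper_pos (hb : Admissible p kinf Qinf b) :
    0 < energyUpper p k Q Qinf b := by
  have := hb.1
  unfold energyUpper
  positivity

/-- The variable s is free because it stands both for w' and for `scaledDeriv`. -/
theorem DecreasingCoeffs.energyLower_mul_le (hc : DecreasingCoeffs k Q kinf Qinf) (hp : 2 < p)
    (hr : 0 ≤ r) {z : ℝ} (hz : |z| ≤ b) (s : ℝ) :
    energyLower p kinf Qinf b * (z ^ 2 + s ^ 2) ≤
      s ^ 2 / 2 + primitive p (k r) (Q r) z := by
  have h1 := coercivity_mul_sq_le_primitive hp hc.pos (hc.le_left r hr) (hc.le_right r hr) hz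
  have h2 := min_le_left 1 (coercivity p kinf Qinf b)
  have h3 := min_le_right 1 (coercivity p kinf Qinf b)
  unfold energyLower
  nlinarith [sq_nonneg z, sq_nonneg s]

theorem DecreasingCoeffs.le_energyUpper_mul (hc : DecreasingCoeffs k Q kinf Qinf) (hp : 2 < p)
    (hr : 0 ≤ r) {z : ℝ} (hz : |z| ≤ b) (s : ℝ) :
    s ^ 2 / 2 + primitive p (k r) (Q r) z ≤ energyUpper p k Q Qinf b * (z ^ 2 + s ^ 2) := by
  have hb0 : 0 ≤ b := (abs_nonneg z).trans hz
  have h1 := hc.abs_right_le hr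
  have h2 : k r ^ 2 ≤ k 0 ^ 2 := by
    have := hc.left_le r hr
    have : 0 ≤ k r := hc.pos.le.trans (hc.le_left r hr)
    gcongr
  have h3 : Q r / p * |z| ^ (p - 2) ≤ (|Q 0| + |Qinf|) * b ^ (p - 2) := by
    have h4 : Q r / p ≤ |Q r| := by
      rw [div_le_iff₀ (by linarith)]
      nlinarith [le_abs_self (Q r), abs_nonneg (Q r)]
    calc Q r / p * |z| ^ (p - 2) ≤ |Q r| * |z| ^ (p - 2) := by gcongr
      _ ≤ _ := by gcongr
  have h5 : 0 ≤ (|Q 0| + |Qinf|) * b ^ (p - 2) := by positivity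
  rw [primitive_eq_sq_mul hp]
  unfold energyUpper
  nlinarith [sq_nonneg z, sq_nonneg s, sq_nonneg (k 0), mul_nonneg (sq_nonneg s) h5,
    mul_nonneg (sq_nonneg s) (sq_nonneg (k 0)), mul_le_mul_of_nonneg_left h3 (sq_nonneg z),
    mul_le_mul_of_nonneg_left h2 (sq_nonneg z)]

/-- The friction in E controls only w'². The correction w w'/(2r), negligible against E for large r,
contributes -(k² + Q|w|^(p-2)) w²/(2r) to the derivative, so the corrected energy H satisfies r H' ≤
-γ H. -/
theorem RadialSolution.exists_sq_add_sq_le_rpow (hc : DecreasingCoeffs k Q kinf Qinf)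
    (hp : 2 < p) (hn : 1 ≤ n) (hb : Admissible p kinf Qinf b)
    (h : RadialSolution n (nonlinearity p k Q) α w φ) (hwb : ∀ r, 0 ≤ r → |w r| ≤ b) :
    ∃ γ C R : ℝ, 0 < γ ∧ 0 ≤ C ∧ 0 < R ∧
      ∀ r, R ≤ r → w r ^ 2 + (r * φ r) ^ 2 ≤ C * r ^ (-γ) := by
  set c := energyLower p kinf Qinf b with hc_def
  set K := energyUpper p k Q Qinf b with hK_def
  have hcpos : 0 < c := hb.energyLower_pos
  have hKpos : 0 < K := hb.energyUpper_pos
  have hc1 : c ≤ 1 / 2 := by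
    have := min_le_left 1 (coercivity p kinf Qinf b)
    rw [hc_def, energyLower]
    linarith
  have hc2 : 2 * c ≤ coercivity p kinf Qinf b := by
    have := min_le_right 1 (coercivity p kinf Qinf b)
    rw [hc_def, energyLower]
    linarith
  -- Beyond R the cross term costs at most (n + 1)/(4r) ≤ c/2, half of the dissipation rate c.
  set R := (n + 1) / (2 * c) with hR_def
  have hR1 : 1 ≤ R := by
    rw [hR_def, le_div_iff₀ (by positivity)]
    linarith
  have hR2 : ∀ r, R ≤ r → (n + 1) / (4 * r) ≤ c / 2 := fun r hr => by
    have : 0 < r := by linarith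
    rw [hR_def, div_le_iff₀ (by positivity)] at hr
    rw [div_le_iff₀ (by positivity)]
    linarith
  -- The remaining rate c/2 divided by the upper constant K + 1 of H.
  set γ := c / (2 * (K + 1)) with hγ_def
  have hγ : 0 < γ := by positivity
  set H : ℝ → ℝ := fun r => energy p k Q w φ r + 1 / 2 * (w r * φ r) with hH_def
  have hcross : ∀ r, 0 < r → |w r * φ r| ≤ 1 / (2 * r) * (w r ^ 2 + (r * φ r) ^ 2) := by
    intro r hr
    have h1 : w r * φ r = (w r * (r * φ r)) / r := by field_simp
    rw [h1, abs_div, abs_of_pos hr, div_le_iff₀ hr, abs_mul]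
    have : 1 / (2 * r) * (w r ^ 2 + (r * φ r) ^ 2) * r = (w r ^ 2 + (r * φ r) ^ 2) / 2 := by
      field_simp
    rw [this, ← sq_abs (w r), ← sq_abs (r * φ r)]
    nlinarith [sq_nonneg (|w r| - |r * φ r|)]
  have hsmall : ∀ r, R ≤ r → 1 / (2 * r) ≤ c / 2 := fun r hr => by
    have hr0 : 0 < r := by linarith
    refine le_trans ?_ (hR2 r hr)
    rw [div_le_div_iff₀ (by positivity) (by positivity)]
    nlinarith
  have hHlow : ∀ r, R ≤ r → c / 2 * (w r ^ 2 + (r * φ r) ^ 2) ≤ H r := by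
    intro r hr
    have hr0 : 0 < r := by linarith
    have h1 := hc.energyLower_mul_le hp hr0.le (hwb r hr0.le) (r * φ r)
    have h2 := neg_le_of_abs_le (hcross r hr0)
    have h3 := mul_le_mul_of_nonneg_right (hsmall r hr)
      (by positivity : 0 ≤ w r ^ 2 + (r * φ r) ^ 2)
    simp only [hH_def, energy]
    nlinarith
  have hHup : ∀ r, R ≤ r → H r ≤ (K + 1) * (w r ^ 2 + (r * φ r) ^ 2) := by
    intro r hr
    have hr0 : 0 < r := by linarith
    have h1 := hc.le_energyUpper_mul hp hr0.le (hwb r hr0.le) (r * φ r)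
    have h2 := le_of_abs_le (hcross r hr0)
    have h3 := mul_le_mul_of_nonneg_right (hsmall r hr)
      (by positivity : 0 ≤ w r ^ 2 + (r * φ r) ^ 2)
    have h4 : 0 ≤ w r ^ 2 + (r * φ r) ^ 2 := by positivity
    simp only [hH_def, energy]
    nlinarith
  set H' : ℝ → ℝ := fun r => -(n * r * φ r ^ 2) + drift p k Q r (w r) +
    1 / 2 * (r * φ r * φ r + w r * ((profileSecond p n k Q w φ r - φ r) / r)) with hH'_def
  have hHd : ∀ r, 0 < r → HasDerivAt H (H' r) r := fun r hr =>
    (hc.hasDerivAt_energy hp hr (h.hasDerivAt r) (h.hasDerivAt_deriv r hr)).add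
      (((h.hasDerivAt r).mul ((h.radialJet hc hp).hasDerivAt_fst hr)).const_mul (1 / 2))
  have hH'le : ∀ r, R ≤ r → r * H' r ≤ -(γ * H r) := by
    intro r hr
    have hr0 : 0 < r := by linarith
    have h1 : r * H' r = -(n * (r * φ r) ^ 2) + r * drift p k Q r (w r) +
        1 / 2 * ((r * φ r) ^ 2 - (n + 1) * (w r * φ r)
          - (k r ^ 2 + Q r * |w r| ^ (p - 2)) * w r ^ 2) := by
      simp only [hH'_def, profileSecond, nonlinearity]
      field_simp
      ring
    have h2 := mul_nonpos_of_nonneg_of_nonpos hr0.le (hc.drift_nonpos hp hr0 (w r))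
    have h3 := coercivity_le hp hc.pos (hc.le_left r hr0.le) (hc.le_right r hr0.le)
      (hwb r hr0.le)
    have h4 := mul_le_mul_of_nonneg_right (hc2.trans h3) (sq_nonneg (w r))
    have h5 := mul_le_mul_of_nonneg_left (neg_le_of_abs_le (hcross r hr0))
      (by linarith : 0 ≤ n + 1)
    have h6 := mul_le_mul_of_nonneg_right (hR2 r hr)
      (by positivity : 0 ≤ w r ^ 2 + (r * φ r) ^ 2)
    have h7 : (n + 1) * -(1 / (2 * r) * (w r ^ 2 + (r * φ r) ^ 2)) =
        -(2 * ((n + 1) / (4 * r) * (w r ^ 2 + (r * φ r) ^ 2))) := by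
      field_simp
      ring
    have h8 : γ * H r ≤ c / 2 * (w r ^ 2 + (r * φ r) ^ 2) := by
      calc γ * H r ≤ γ * ((K + 1) * (w r ^ 2 + (r * φ r) ^ 2)) := by
            gcongr
            exact hHup r hr
        _ = _ := by
            rw [hγ_def]
            field_simp
    rw [h1]
    nlinarith [mul_le_mul_of_nonneg_right hn (sq_nonneg (r * φ r)),
      mul_le_mul_of_nonneg_right hc1 (sq_nonneg (r * φ r))]
  have hanti : AntitoneOn (fun r => r ^ γ * H r) (Ici R) := by
    refine antitoneOn_of_hasDerivWithinAt_nonpos (convex_Ici R)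
      (f' := fun r => γ * r ^ (γ - 1) * H r + r ^ γ * H' r) (fun r hr => ?_)
      (fun r hr => ?_) (fun r hr => ?_)
    · have hr0 : 0 < r := by linarith [mem_Ici.1 hr]
      exact (((Real.hasDerivAt_rpow_const (Or.inl hr0.ne')).mul
        (hHd r hr0)).continuousAt).continuousWithinAt
    · rw [interior_Ici] at hr
      have hr0 : 0 < r := by linarith [mem_Ioi.1 hr]
      exact ((Real.hasDerivAt_rpow_const (Or.inl hr0.ne')).mul (hHd r hr0)).hasDerivWithinAt
    · rw [interior_Ici] at hr
      have hr0 : 0 < r := by linarith [mem_Ioi.1 hr]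
      have h1 : r ^ γ = r ^ (γ - 1) * r := by
        rw [← Real.rpow_add_one hr0.ne']
        congr 1
        ring
      have h2 := hH'le r (mem_Ioi.1 hr).le
      have h3 : 0 ≤ r ^ (γ - 1) := by positivity
      rw [h1]
      nlinarith
  have hHR : 0 ≤ H R := (by positivity : 0 ≤ c / 2 * (w R ^ 2 + (R * φ R) ^ 2)).trans
    (hHlow R le_rfl)
  refine ⟨γ, 2 / c * (R ^ γ * H R), R, hγ, by positivity, by linarith, fun r hr => ?_⟩
  have hr0 : 0 < r := by linarith
  have h1 := hanti self_mem_Ici hr hr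
  have h2 := hHlow r hr
  have h3 : H r ≤ R ^ γ * H R * r ^ (-γ) := by
    rw [Real.rpow_neg hr0.le, ← div_eq_mul_inv, le_div_iff₀ (by positivity)]
    simpa [mul_comm] using h1
  have h4 : w r ^ 2 + (r * φ r) ^ 2 ≤ 2 / c * H r := by
    rw [div_mul_eq_mul_div, le_div_iff₀ hcpos]
    linarith
  calc _ ≤ 2 / c * H r := h4
    _ ≤ 2 / c * (R ^ γ * H R * r ^ (-γ)) := by gcongr
    _ = _ := by ring

theorem RadialSolution.tendsto_sq_add_sq (hc : DecreasingCoeffs k Q kinf Qinf)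
    (hp : 2 < p) (hn : 1 ≤ n) (hb : Admissible p kinf Qinf b)
    (h : RadialSolution n (nonlinearity p k Q) α w φ) (hwb : ∀ r, 0 ≤ r → |w r| ≤ b) :
    Tendsto (fun r => w r ^ 2 + (r * φ r) ^ 2) atTop (𝓝 0) := by
  obtain ⟨γ, C, R, hγ, -, -, hle⟩ := h.exists_sq_add_sq_le_rpow hc hp hn hb hwb
  have h1 : Tendsto (fun r : ℝ => C * r ^ (-γ)) atTop (𝓝 0) := by
    simpa using (tendsto_rpow_neg_atTop hγ).const_mul C
  refine squeeze_zero' (Eventually.of_forall fun r => by positivity) ?_ h1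
  filter_upwards [eventually_ge_atTop R] with r hr using hle r hr

/-- Any positive rate suffices: it makes |w|^(p-2)/r integrable at infinity. Below R the bound |w| ≤
b is absorbed in the constant. -/
theorem RadialSolution.exists_abs_rpow_le_rpow (hc : DecreasingCoeffs k Q kinf Qinf)
    (hp : 2 < p) (hn : 1 ≤ n) (hb : Admissible p kinf Qinf b)
    (h : RadialSolution n (nonlinearity p k Q) α w φ) (hwb : ∀ r, 0 ≤ r → |w r| ≤ b) :
    ∃ γ C : ℝ, 0 < γ ∧ 0 ≤ C ∧ ∀ r, 0 < r → |w r| ^ (p - 2) ≤ C * r ^ (-γ) := by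
  obtain ⟨γ, C, R, hγ, hC, hR, hle⟩ := h.exists_sq_add_sq_le_rpow hc hp hn hb hwb
  have hp2 : 0 < (p - 2) / 2 := by linarith
  have hb0 := hb.1
  refine ⟨γ * ((p - 2) / 2), C ^ ((p - 2) / 2) + b ^ (p - 2) * R ^ (γ * ((p - 2) / 2)),
    by positivity, by positivity, fun r hr => ?_⟩
  rcases le_total R r with hRr | hRr
  · have h1 : w r ^ 2 ≤ C * r ^ (-γ) :=
      (le_add_of_nonneg_right (sq_nonneg _)).trans (hle r hRr)
    have h2 : |w r| ^ (p - 2) = (w r ^ 2) ^ ((p - 2) / 2) := by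
      rw [← sq_abs, ← Real.rpow_natCast, ← Real.rpow_mul (abs_nonneg _)]
      congr 1
      push_cast
      ring
    calc |w r| ^ (p - 2) = (w r ^ 2) ^ ((p - 2) / 2) := h2
      _ ≤ (C * r ^ (-γ)) ^ ((p - 2) / 2) := by gcongr
      _ = C ^ ((p - 2) / 2) * r ^ (-(γ * ((p - 2) / 2))) := by
        rw [Real.mul_rpow hC (by positivity), ← Real.rpow_mul hr.le, neg_mul]
      _ ≤ _ := by
        gcongr
        exact le_add_of_nonneg_right (by positivity)
  · have h1 : 1 ≤ R ^ (γ * ((p - 2) / 2)) * r ^ (-(γ * ((p - 2) / 2))) := by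
      rw [Real.rpow_neg hr.le, ← div_eq_mul_inv, one_le_div (by positivity)]
      gcongr
    calc |w r| ^ (p - 2) ≤ b ^ (p - 2) * 1 := by
          rw [mul_one]
          gcongr
          exact hwb r hr.le
      _ ≤ b ^ (p - 2) * (R ^ (γ * ((p - 2) / 2)) * r ^ (-(γ * ((p - 2) / 2)))) := by gcongr
      _ = b ^ (p - 2) * R ^ (γ * ((p - 2) / 2)) * r ^ (-(γ * ((p - 2) / 2))) := by ring
      _ ≤ _ := by
        gcongr
        exact le_add_of_nonneg_left (by positivity)

/-! ### The rescaled energy -/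

/-- A two-sided Gronwall estimate. -/
theorem gronwall_two_sided {F F' Φ Φ' : ℝ → ℝ} (hF : ∀ r, 0 < r → HasDerivAt F (F' r) r)
    (hΦ : ∀ r, 0 < r → HasDerivAt Φ (Φ' r) r) (hle : ∀ r, 0 < r → |F' r| ≤ -Φ' r * F r) {s : ℝ}
    (hs : 0 < s) (hsr : s ≤ r) :
    F s * Real.exp (Φ r - Φ s) ≤ F r ∧ F r ≤ F s * Real.exp (Φ s - Φ r) := by
  have hsub : ∀ t ∈ Ici s, 0 < t := fun t ht => hs.trans_le ht
  have hd1 : ∀ t, 0 < t → HasDerivAt (fun t => F t * Real.exp (Φ t))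
      (F' t * Real.exp (Φ t) + F t * (Real.exp (Φ t) * Φ' t)) t := fun t ht =>
    (hF t ht).mul (hΦ t ht).exp
  have hd2 : ∀ t, 0 < t → HasDerivAt (fun t => F t * Real.exp (-Φ t))
      (F' t * Real.exp (-Φ t) + F t * (Real.exp (-Φ t) * -Φ' t)) t := fun t ht =>
    (hF t ht).mul (hΦ t ht).neg.exp
  have h1 : AntitoneOn (fun t => F t * Real.exp (Φ t)) (Ici s) := by
    refine antitoneOn_of_hasDerivWithinAt_nonpos (convex_Ici s)
      (fun t ht => (hd1 t (hsub t ht)).continuousAt.continuousWithinAt)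
      (fun t ht => (hd1 t (hsub t (interior_subset ht))).hasDerivWithinAt) (fun t ht => ?_)
    have h2 := le_of_abs_le (hle t (hsub t (interior_subset ht)))
    nlinarith [Real.exp_pos (Φ t)]
  have h2 : MonotoneOn (fun t => F t * Real.exp (-Φ t)) (Ici s) := by
    refine monotoneOn_of_hasDerivWithinAt_nonneg (convex_Ici s)
      (fun t ht => (hd2 t (hsub t ht)).continuousAt.continuousWithinAt)
      (fun t ht => (hd2 t (hsub t (interior_subset ht))).hasDerivWithinAt) (fun t ht => ?_)
    have h3 := neg_le_of_abs_le (hle t (hsub t (interior_subset ht)))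
    nlinarith [Real.exp_pos (-Φ t)]
  have h3 := h1 self_mem_Ici hsr hsr
  have h4 := h2 self_mem_Ici hsr hsr
  simp only [Real.exp_neg] at h3 h4
  rw [Real.exp_sub, Real.exp_sub, mul_div_assoc', mul_div_assoc', div_le_iff₀ (Real.exp_pos _),
    le_div_iff₀ (Real.exp_pos _)]
  refine ⟨?_, h3⟩
  rwa [← div_eq_mul_inv, ← div_eq_mul_inv, div_le_div_iff₀ (Real.exp_pos _) (Real.exp_pos _)] at h4

/-- The derivative of `r^(n/2) w`, divided by `r^(n/2)`. -/
def scaledDeriv (n : ℝ) (w φ : ℝ → ℝ) (r : ℝ) : ℝ := r * φ r + n / 2 * (w r / r)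

theorem RadialSolution.hasDerivAt_scaledDeriv
    (h : RadialSolution n (nonlinearity p k Q) α w φ) (hr : 0 < r) :
    HasDerivAt (scaledDeriv n w φ)
      (-(n / 2 * φ r) - nonlinearity p k Q r (w r) - n / 2 * w r / r ^ 2) r := by
  have h1 := (h.hasDerivAt_deriv r hr).add
    (((h.hasDerivAt r).div (hasDerivAt_id r) hr.ne').const_mul (n / 2))
  refine h1.congr_deriv ?_
  simp only [id]
  field_simp
  ring

/-- The energy of `r^(n/2) w`, divided by `r^n`. -/
def scaledEnergy (p n : ℝ) (k Q w φ : ℝ → ℝ) (r : ℝ) : ℝ :=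
  scaledDeriv n w φ r ^ 2 / 2 + primitive p (k r) (Q r) (w r)

/-- Rescaling by r^(n/2) removes the friction. What remains is the drift, a term of order |w|^p/r
that would vanish for p = 2, and a potential term of order r^(-2). -/
theorem RadialSolution.hasDerivAt_rpow_mul_scaledEnergy (hc : DecreasingCoeffs k Q kinf Qinf)
    (hp : 2 < p) (h : RadialSolution n (nonlinearity p k Q) α w φ) (hr : 0 < r) :
    HasDerivAt (fun r => r ^ n * scaledEnergy p n k Q w φ r)
      (r ^ n * (drift p k Q r (w r) + n / r * (Q r * |w r| ^ p * (1 / p - 1 / 2)) +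
        n / 2 * (n / 2 - 1) * (scaledDeriv n w φ r * w r / r ^ 2))) r := by
  have h1 : HasDerivAt (scaledEnergy p n k Q w φ) _ r :=
    (((h.hasDerivAt_scaledDeriv hr).pow 2).div_const 2).add
      (hc.hasDerivAt_primitive hp hr (h.hasDerivAt r))
  have h2 := (Real.hasDerivAt_rpow_const (p := n) (Or.inl hr.ne')).mul h1
  refine h2.congr_deriv ?_
  have h3 : r ^ n = r ^ (n - 1) * r := by
    rw [← Real.rpow_add_one hr.ne']
    congr 1
    ring
  have hp0 : p ≠ 0 := by linarith
  rw [h3]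
  generalize r ^ (n - 1) = ρ
  simp only [scaledEnergy, primitive, nonlinearity, scaledDeriv, abs_rpow_eq_sq_mul hp,
    Nat.reduceSub, pow_one, Nat.cast_ofNat]
  field_simp
  ring

/-- Each remaining term is at most an integrable rate times F. The rates add up to -Φ', and Φ is
bounded below, so F stays comparable to a positive initial value. -/
theorem RadialSolution.exists_scaledEnergy_bounds (hc : DecreasingCoeffs k Q kinf Qinf)
    (hp : 2 < p) (hn : 1 ≤ n) (hb : Admissible p kinf Qinf b)
    (h : RadialSolution n (nonlinearity p k Q) α w φ) (hwb : ∀ r, 0 ≤ r → |w r| ≤ b)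
    (hα : α ≠ 0) :
    ∃ c C : ℝ, 0 < c ∧ 0 < C ∧ ∀ r, 1 ≤ r →
      c ≤ r ^ n * scaledEnergy p n k Q w φ r ∧ r ^ n * scaledEnergy p n k Q w φ r ≤ C := by
  obtain ⟨γ, B, hγ, hB, hwγ⟩ := h.exists_abs_rpow_le_rpow hc hp hn hb hwb
  set c := energyLower p kinf Qinf b with hc_def
  have hcpos : 0 < c := hb.energyLower_pos
  have hb0 := hb.1
  have hk0 : 0 < k 0 := hc.pos.trans_le (hc.le_left 0 le_rfl)
  set B₁ := n * ((|Q 0| + |Qinf|) * B) with hB₁_def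
  have hB₁ : 0 ≤ B₁ := by positivity
  set B₂ := |n / 2 * (n / 2 - 1)| with hB₂_def
  have hB₂ : 0 ≤ B₂ := abs_nonneg _
  set F : ℝ → ℝ := fun r => r ^ n * scaledEnergy p n k Q w φ r with hF_def
  -- One summand per error: k and Q for the drift, r^(-γ) for the superquadratic term, 1/r for the
  -- potential. Division by c bounds w² + s² by the energy.
  set Φ : ℝ → ℝ := fun r => (k 0 * k r + b ^ (p - 2) * Q r + B₁ / γ * r ^ (-γ) + B₂ * r⁻¹) / c
    with hΦ_def
  have hΦ : ∀ r, 0 < r → HasDerivAt Φ ((k 0 * deriv k r + b ^ (p - 2) * deriv Q r +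
      B₁ / γ * (-γ * r ^ (-γ - 1)) + B₂ * -(r ^ 2)⁻¹) / c) r := fun r hr =>
    (((((hc.hasDerivAt_left r hr).const_mul (k 0)).add
      ((hc.hasDerivAt_right r hr).const_mul (b ^ (p - 2)))).add
      ((Real.hasDerivAt_rpow_const (Or.inl hr.ne')).const_mul (B₁ / γ))).add
      ((hasDerivAt_inv hr.ne').const_mul B₂)).div_const c
  have hD : ∀ r, 0 < r → c * (w r ^ 2 + scaledDeriv n w φ r ^ 2) ≤ scaledEnergy p n k Q w φ r :=
    fun r hr => hc.energyLower_mul_le hp hr.le (hwb r hr.le) _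
  have hle : ∀ r, 0 < r → |r ^ n * (drift p k Q r (w r) +
      n / r * (Q r * |w r| ^ p * (1 / p - 1 / 2)) +
      n / 2 * (n / 2 - 1) * (scaledDeriv n w φ r * w r / r ^ 2))| ≤
      -((k 0 * deriv k r + b ^ (p - 2) * deriv Q r +
      B₁ / γ * (-γ * r ^ (-γ - 1)) + B₂ * -(r ^ 2)⁻¹) / c) * F r := by
    intro r hr
    set s := scaledDeriv n w φ r with hs_def
    set D := scaledEnergy p n k Q w φ r with hD_def
    have hDr : w r ^ 2 + s ^ 2 ≤ D / c := by
      rw [le_div_iff₀ hcpos, mul_comm]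
      exact hD r hr
    have hk' := hc.deriv_left_nonpos r hr
    have hQ' := hc.deriv_right_nonpos r hr
    have hw2 : w r ^ 2 ≤ D / c := by linarith [sq_nonneg s]
    have hDc : 0 ≤ D / c := (sq_nonneg _).trans hw2
    have e1 : |drift p k Q r (w r)| ≤
        -(k 0 * deriv k r + b ^ (p - 2) * deriv Q r) * (D / c) := by
      rw [abs_of_nonpos (hc.drift_nonpos hp hr (w r)), drift, abs_rpow_eq_sq_mul hp]
      have t1 : k r * -deriv k r * w r ^ 2 ≤ k 0 * -deriv k r * (D / c) := by
        have := hc.left_le r hr.le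
        have := neg_nonneg.2 hk'
        gcongr
      have t2 : -deriv Q r / p * (w r ^ 2 * |w r| ^ (p - 2)) ≤
          -deriv Q r * (D / c * b ^ (p - 2)) := by
        have := neg_nonneg.2 hQ'
        have : -deriv Q r / p ≤ -deriv Q r := div_le_self this (by linarith)
        have := hwb r hr.le
        gcongr
      rw [neg_div] at t2
      linarith
    have e2 : |n / r * (Q r * |w r| ^ p * (1 / p - 1 / 2))| ≤ B₁ * r ^ (-γ - 1) * (D / c) := by
      have t1 : |1 / p - 1 / 2| ≤ 1 := by
        have : 0 < 1 / p := by positivity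
        have : 1 / p ≤ 1 / 2 := one_div_le_one_div_of_le (by norm_num) hp.le
        rw [abs_le]
        constructor <;> linarith
      have t2 : |w r| ^ p ≤ (B * r ^ (-γ)) * (D / c) := by
        rw [abs_rpow_eq_sq_mul hp, mul_comm]
        exact mul_le_mul (hwγ r hr) hw2 (sq_nonneg _) (by positivity)
      rw [abs_mul, abs_mul, abs_mul, abs_of_nonneg (by positivity : 0 ≤ n / r),
        abs_of_nonneg (by positivity : 0 ≤ |w r| ^ p)]
      calc n / r * (|Q r| * |w r| ^ p * |1 / p - 1 / 2|) ≤
          n / r * ((|Q 0| + |Qinf|) * (B * r ^ (-γ) * (D / c)) * 1) := by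
            have := hc.abs_right_le hr.le
            gcongr
        _ = _ := by
            rw [Real.rpow_sub_one hr.ne', hB₁_def]
            ring
    have e3 : |n / 2 * (n / 2 - 1) * (s * w r / r ^ 2)| ≤ B₂ * (r ^ 2)⁻¹ * (D / c) := by
      have t1 : |s * w r| ≤ D / c := by
        rw [abs_mul]
        nlinarith [sq_nonneg (|s| - |w r|), sq_abs s, sq_abs (w r)]
      rw [abs_mul, abs_div, abs_of_nonneg (sq_nonneg r), ← hB₂_def, div_eq_mul_inv,
        mul_comm |s * w r|, ← mul_assoc]
      gcongr
    have e4 := abs_add_le (drift p k Q r (w r) + n / r * (Q r * |w r| ^ p * (1 / p - 1 / 2)))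
      (n / 2 * (n / 2 - 1) * (s * w r / r ^ 2))
    have e5 := abs_add_le (drift p k Q r (w r)) (n / r * (Q r * |w r| ^ p * (1 / p - 1 / 2)))
    have hrn : 0 < r ^ n := by positivity
    rw [abs_mul, abs_of_pos hrn]
    have e6 : -((k 0 * deriv k r + b ^ (p - 2) * deriv Q r +
        B₁ / γ * (-γ * r ^ (-γ - 1)) + B₂ * -(r ^ 2)⁻¹) / c) * F r =
        r ^ n * (-(k 0 * deriv k r + b ^ (p - 2) * deriv Q r) * (D / c) +
          B₁ * r ^ (-γ - 1) * (D / c) + B₂ * (r ^ 2)⁻¹ * (D / c)) := by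
      simp only [hF_def, ← hD_def]
      field_simp
      ring
    rw [e6]
    gcongr
    linarith
  have hΦlow : ∀ r, 0 < r → (k 0 * kinf + b ^ (p - 2) * Qinf) / c ≤ Φ r := by
    intro r hr
    have t1 := hc.le_left r hr.le
    have t2 := hc.le_right r hr.le
    have t3 : 0 ≤ B₁ / γ * r ^ (-γ) := by positivity
    have t4 : 0 ≤ B₂ * r⁻¹ := by positivity
    refine div_le_div_of_nonneg_right ?_ hcpos.le
    have t5 : k 0 * kinf ≤ k 0 * k r := by gcongr
    have t6 : b ^ (p - 2) * Qinf ≤ b ^ (p - 2) * Q r := by gcongr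
    linarith
  -- Gronwall must start at a positive radius. Near 0, w is close to α ≠ 0, which makes F(e)
  -- positive.
  obtain ⟨e, he0, he1, hwe⟩ : ∃ e, 0 < e ∧ e ≤ 1 ∧ w e ≠ 0 := by
    have h1 : ∀ᶠ r in 𝓝[>] (0 : ℝ), w r ≠ 0 := by
      have : Tendsto w (𝓝[>] 0) (𝓝 (w 0)) := (h.continuous.tendsto 0).mono_left inf_le_left
      exact this.eventually_ne (by rw [h.apply_zero]; exact hα)
    have h2 : ∀ᶠ r in 𝓝[>] (0 : ℝ), r ∈ Ioc (0 : ℝ) 1 := Ioc_mem_nhdsGT one_pos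
    obtain ⟨e, h3, h4⟩ := (h1.and h2).exists
    exact ⟨e, h4.1, h4.2, h3⟩
  have hFe : 0 < F e := by
    have t1 := hD e he0
    have t2 : 0 < w e ^ 2 := by positivity
    have t3 : 0 < c * (w e ^ 2 + scaledDeriv n w φ e ^ 2) := by positivity
    have t4 : 0 < scaledEnergy p n k Q w φ e := t3.trans_le t1
    simp only [hF_def]
    positivity
  refine ⟨F e * Real.exp ((k 0 * kinf + b ^ (p - 2) * Qinf) / c - Φ e),
    F e * Real.exp (Φ e - (k 0 * kinf + b ^ (p - 2) * Qinf) / c), by positivity, by positivity,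
    fun r hr => ?_⟩
  have hr0 : 0 < r := by linarith
  obtain ⟨g1, g2⟩ := gronwall_two_sided
    (fun r hr => h.hasDerivAt_rpow_mul_scaledEnergy hc hp hr) hΦ hle he0 (he1.trans hr)
  have hΦr := hΦlow r hr0
  constructor
  · refine le_trans ?_ g1
    gcongr
  · refine g2.trans ?_
    gcongr

/-- With t = w/r this compares w' and `scaledDeriv` for r ≥ 1; the reverse comparison is the case
-n. -/
theorem sq_add_shift_sq_le (n : ℝ) {x t : ℝ} (v : ℝ) (ht : t ^ 2 ≤ x ^ 2) :
    x ^ 2 + (v + n / 2 * t) ^ 2 ≤ (2 + n ^ 2) * (x ^ 2 + v ^ 2) := by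
  have h1 : n ^ 2 * t ^ 2 ≤ n ^ 2 * x ^ 2 := by gcongr
  nlinarith [sq_nonneg (v - n / 2 * t), mul_nonneg (sq_nonneg n) (sq_nonneg v), sq_nonneg x,
    mul_nonneg (sq_nonneg n) (sq_nonneg x)]

theorem sq_add_sq_le_sq_sum (x v y : ℝ) : x ^ 2 + v ^ 2 ≤ (|x| + |v| + |y|) ^ 2 := by
  have h1 := abs_nonneg x
  have h2 := abs_nonneg v
  have h3 := abs_nonneg y
  rw [← sq_abs x, ← sq_abs v]
  nlinarith [mul_nonneg h1 h2, mul_nonneg h1 h3, mul_nonneg h2 h3]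

theorem sq_sum_le {n L x v y : ℝ} (hn : 0 ≤ n) (hL : 0 ≤ L) (hy : |y| ≤ n * |v| + L * |x|) :
    (|x| + |v| + |y|) ^ 2 ≤ 2 * (1 + n + L) ^ 2 * (x ^ 2 + v ^ 2) := by
  have h1 : |x| + |v| + |y| ≤ (1 + n + L) * (|x| + |v|) := by
    have h2 := mul_nonneg hL (abs_nonneg v)
    have h3 := mul_nonneg hn (abs_nonneg x)
    linarith
  have h2 : (|x| + |v|) ^ 2 ≤ 2 * (x ^ 2 + v ^ 2) := by
    rw [← sq_abs x, ← sq_abs v]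
    nlinarith [sq_nonneg (|x| - |v|)]
  calc (|x| + |v| + |y|) ^ 2 ≤ ((1 + n + L) * (|x| + |v|)) ^ 2 := by gcongr
    _ = (1 + n + L) ^ 2 * (|x| + |v|) ^ 2 := by ring
    _ ≤ (1 + n + L) ^ 2 * (2 * (x ^ 2 + v ^ 2)) := by gcongr
    _ = _ := by ring

/-- For r ≥ 1 the scaled energy is comparable to w² + w'², and the equation bounds w'' by w and w'.
The lower bound needs nothing about w''. -/
theorem RadialSolution.exists_two_sided_bound (hc : DecreasingCoeffs k Q kinf Qinf)
    (hp : 2 < p) (hn : 1 ≤ n) (hb : Admissible p kinf Qinf b)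
    (h : RadialSolution n (nonlinearity p k Q) α w φ) (hwb : ∀ r, 0 ≤ r → |w r| ≤ b)
    (hα : α ≠ 0) :
    ∃ c C : ℝ, 0 < c ∧ 0 < C ∧ ∀ r, 1 ≤ r →
      c * r ^ (-n / 2) ≤ |w r| + |r * φ r| + |profileSecond p n k Q w φ r| ∧
      |w r| + |r * φ r| + |profileSecond p n k Q w φ r| ≤ C * r ^ (-n / 2) := by
  obtain ⟨d, C, hd, hC, hdC⟩ := h.exists_scaledEnergy_bounds hc hp hn hb hwb hα
  set c := energyLower p kinf Qinf b with hc_def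
  set K := energyUpper p k Q Qinf b with hK_def
  have hcpos : 0 < c := hb.energyLower_pos
  have hKpos : 0 < K := hb.energyUpper_pos
  set L := lipschitzBound p k Q Qinf b with hL_def
  have hL : 0 ≤ L := by
    have : 0 ≤ p - 1 := by linarith
    have := hb.1
    rw [hL_def]
    unfold lipschitzBound
    positivity
  set A := 2 + n ^ 2 with hA_def
  have hA : 0 < A := by positivity
  set M := 1 + n + L with hM_def
  have hM : 1 ≤ M := by linarith
  refine ⟨√(d / (K * A)), √(2 * M ^ 2 * (A * C / c)), by positivity, by positivity,
    fun r hr => ?_⟩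
  have hr0 : 0 < r := by linarith
  set s := scaledDeriv n w φ r with hs_def
  set v := r * φ r with hv_def
  set T := |w r| + |v| + |profileSecond p n k Q w φ r| with hT_def
  have hT0 : 0 ≤ T := by positivity
  have hD1 := hc.energyLower_mul_le hp hr0.le (hwb r hr0.le) s
  have hD2 := hc.le_energyUpper_mul hp hr0.le (hwb r hr0.le) s
  obtain ⟨hdr, hCr⟩ := hdC r hr
  set D := scaledEnergy p n k Q w φ r with hD_def
  have hD1' : c * (w r ^ 2 + s ^ 2) ≤ D := hD1
  have hD2' : D ≤ K * (w r ^ 2 + s ^ 2) := hD2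
  have hsv : s = v + n / 2 * (w r / r) := rfl
  have hwr : (w r / r) ^ 2 ≤ w r ^ 2 := by
    rw [div_pow]
    exact div_le_self (sq_nonneg _) (one_le_pow₀ hr)
  have hs2 : w r ^ 2 + s ^ 2 ≤ A * (w r ^ 2 + v ^ 2) := by
    rw [hsv]
    exact sq_add_shift_sq_le n v hwr
  have hv2 : w r ^ 2 + v ^ 2 ≤ A * (w r ^ 2 + s ^ 2) := by
    have h1 := sq_add_shift_sq_le (-n) s hwr
    have h2 : s + -n / 2 * (w r / r) = v := by rw [hsv]; ring
    rwa [h2, neg_sq] at h1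
  have hrn : (r ^ (-n / 2)) ^ 2 = (r ^ n)⁻¹ := by
    rw [← Real.rpow_natCast, ← Real.rpow_mul hr0.le, ← Real.rpow_neg hr0.le]
    congr 1
    push_cast
    ring
  have hrpos : 0 < r ^ n := by positivity
  have hφ : |φ r| ≤ |v| := by
    rw [hv_def, abs_mul, abs_of_pos hr0]
    exact le_mul_of_one_le_left (abs_nonneg _) hr
  have hf : |nonlinearity p k Q r (w r)| ≤ L * |w r| := by
    have := hc.abs_nonlinearity_sub_le hp hr0.le (hwb r hr0.le) (y := 0) (by simpa using hb.1)
    simpa [nonlinearity_zero] using this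
  have hψ : |profileSecond p n k Q w φ r| ≤ n * |v| + L * |w r| := by
    unfold profileSecond
    refine (abs_sub _ _).trans ?_
    rw [abs_neg, abs_mul, abs_of_pos (by linarith : 0 < n)]
    gcongr
  have hT1 : w r ^ 2 + v ^ 2 ≤ T ^ 2 := sq_add_sq_le_sq_sum (w r) v _
  have hT2 : T ^ 2 ≤ 2 * M ^ 2 * (w r ^ 2 + v ^ 2) :=
    sq_sum_le (by linarith) hL hψ
  constructor
  · refine (sq_le_sq₀ (by positivity) hT0).1 ?_
    rw [mul_pow, Real.sq_sqrt (by positivity), hrn]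
    have h1 : d * (r ^ n)⁻¹ ≤ D := by
      rw [← div_eq_mul_inv, div_le_iff₀ hrpos, mul_comm]
      exact hdr
    have h2 : D ≤ (K * A) * T ^ 2 := by
      calc D ≤ K * (A * (w r ^ 2 + v ^ 2)) := hD2'.trans (by gcongr)
        _ ≤ K * (A * T ^ 2) := by gcongr
        _ = _ := by ring
    rw [div_mul_eq_mul_div, div_le_iff₀ (by positivity)]
    linarith
  · refine (sq_le_sq₀ hT0 (by positivity)).1 ?_
    rw [mul_pow, Real.sq_sqrt (by positivity), hrn]
    have h1 : D ≤ C * (r ^ n)⁻¹ := by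
      rw [← div_eq_mul_inv, le_div_iff₀ hrpos, mul_comm]
      exact hCr
    calc T ^ 2 ≤ 2 * M ^ 2 * (w r ^ 2 + v ^ 2) := hT2
      _ ≤ 2 * M ^ 2 * (A * (D / c)) := by
        gcongr
        refine hv2.trans ?_
        gcongr
        rw [le_div_iff₀ hcpos, mul_comm]
        exact hD1'
      _ ≤ 2 * M ^ 2 * (A * (C * (r ^ n)⁻¹ / c)) := by gcongr
      _ = _ := by ring

end Decay

/-! ### Oscillation -/

section Oscillation

variable {p n α kinf Qinf b r : ℝ} {k Q w φ : ℝ → ℝ}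

theorem RadialSolution.hasDerivAt_rpow_mul_scaledDeriv
    (h : RadialSolution n (nonlinearity p k Q) α w φ) (hr : 0 < r) :
    HasDerivAt (fun r => r ^ (n / 2) * scaledDeriv n w φ r)
      (r ^ (n / 2) * (-nonlinearity p k Q r (w r) + n / 2 * (n / 2 - 1) * (w r / r ^ 2))) r := by
  have h2 := (Real.hasDerivAt_rpow_const (p := n / 2) (Or.inl hr.ne')).mul
    (h.hasDerivAt_scaledDeriv hr)
  refine h2.congr_deriv ?_
  rw [Real.rpow_sub_one hr.ne', scaledDeriv]
  field_simp
  ring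

theorem RadialSolution.hasDerivAt_rpow_mul
    (h : RadialSolution n (nonlinearity p k Q) α w φ) (hr : 0 < r) :
    HasDerivAt (fun r => r ^ (n / 2) * w r) (r ^ (n / 2) * scaledDeriv n w φ r) r := by
  have h2 := (Real.hasDerivAt_rpow_const (p := n / 2) (Or.inl hr.ne')).mul (h.hasDerivAt r)
  refine h2.congr_deriv ?_
  rw [Real.rpow_sub_one hr.ne', scaledDeriv]
  field_simp
  ring

/-- Sturm comparison with the sine. -/
theorem RadialSolution.exists_zero_ge (hc : DecreasingCoeffs k Q kinf Qinf)
    (hp : 2 < p) (hb : Admissible p kinf Qinf b)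
    (h : RadialSolution n (nonlinearity p k Q) α w φ) (hwb : ∀ r, 0 ≤ r → |w r| ≤ b) (R : ℝ) :
    ∃ r, R ≤ r ∧ w r = 0 := by
  by_contra! hcon
  set c := coercivity p kinf Qinf b with hc_def
  have hcpos : 0 < c := hb.coercivity_pos
  set B := |n / 2 * (n / 2 - 1)| with hB_def
  -- Beyond a the potential n/2 (n/2 - 1)/r² is at most c/2, so r^(n/2) w satisfies a linear
  -- equation with coefficient at least c/2 = ω².
  set a := max (max R 1) (B / (c / 2)) with ha_def
  have haR : R ≤ a := (le_max_left _ _).trans (le_max_left _ _)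
  have ha1 : 1 ≤ a := (le_max_right _ _).trans (le_max_left _ _)
  have haB : B ≤ a * (c / 2) := by
    rw [← div_le_iff₀ (by positivity)]
    exact le_max_right _ _
  set ω := √(c / 2) with hω_def
  have hω : 0 < ω := Real.sqrt_pos.2 (by positivity)
  have hω2 : ω ^ 2 = c / 2 := Real.sq_sqrt (by positivity)
  -- The factor w(a) normalises the sign: with no zero beyond a, σ w stays positive.
  set σ := w a with hσ_def
  have hσ : σ ≠ 0 := hcon a haR
  have hpos : ∀ r, a ≤ r → 0 < σ * w r := by
    intro r hr
    by_contra! hle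
    have hcont : ContinuousOn (fun r => σ * w r) (Icc a r) :=
      (continuous_const.mul h.continuous).continuousOn
    obtain ⟨t, ht, ht0⟩ := intermediate_value_Icc' hr hcont
      ⟨hle, (mul_self_pos.2 hσ).le⟩
    rcases mul_eq_zero.1 ht0 with h0 | h0
    · exact hσ h0
    · exact hcon t (haR.trans ht.1) h0
  set e := a + Real.pi / ω with he_def
  have hae : a < e := by
    have : 0 < Real.pi / ω := div_pos Real.pi_pos hω
    linarith
  have hωe : ω * (e - a) = Real.pi := by
    rw [he_def]
    field_simp
    ring
  -- Wronskian of r^(n/2) w with a sine. It is nonincreasing over one half-period, yet negative at a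
  -- and positive at e.
  set W : ℝ → ℝ := fun r => σ * (r ^ (n / 2) * scaledDeriv n w φ r * Real.sin (ω * (r - a)) -
    ω * (r ^ (n / 2) * w r * Real.cos (ω * (r - a)))) with hW_def
  have hWd : ∀ r, 0 < r → HasDerivAt W (-((σ * w r) * (r ^ (n / 2) * Real.sin (ω * (r - a)) *
      (k r ^ 2 + Q r * |w r| ^ (p - 2) - n / 2 * (n / 2 - 1) / r ^ 2 - ω ^ 2)))) r := by
    intro r hr
    have hlin : HasDerivAt (fun r => ω * (r - a)) ω r := by
      simpa using ((hasDerivAt_id r).sub_const a).const_mul ω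
    have h1 := (((h.hasDerivAt_rpow_mul_scaledDeriv hr).mul hlin.sin).sub
      (((h.hasDerivAt_rpow_mul hr).mul hlin.cos).const_mul ω)).const_mul σ
    refine h1.congr_deriv ?_
    unfold nonlinearity
    field_simp
    ring
  have hanti : AntitoneOn W (Icc a e) := by
    refine antitoneOn_of_hasDerivWithinAt_nonpos (convex_Icc a e)
      (fun r hr => (hWd r (by linarith [hr.1])).continuousAt.continuousWithinAt)
      (fun r hr => (hWd r (by linarith [(interior_subset hr).1])).hasDerivWithinAt)
      (fun r hr => ?_)
    rw [interior_Icc] at hr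
    have hr1 : 1 ≤ r := by linarith [hr.1]
    have hr0 : 0 < r := by linarith
    have h1 : 0 ≤ Real.sin (ω * (r - a)) := by
      refine Real.sin_nonneg_of_nonneg_of_le_pi (mul_nonneg hω.le (by linarith [hr.1])) ?_
      rw [← hωe]
      gcongr
      exact hr.2.le
    have h2 := coercivity_le hp hc.pos (hc.le_left r hr0.le) (hc.le_right r hr0.le)
      (hwb r hr0.le)
    have h3 : n / 2 * (n / 2 - 1) / r ^ 2 ≤ c / 2 := by
      rw [div_le_iff₀ (by positivity)]
      have h4 : a ≤ r ^ 2 := by nlinarith [hr.1]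
      have h5 := le_abs_self (n / 2 * (n / 2 - 1))
      have h6 := mul_le_mul_of_nonneg_left h4 (by positivity : 0 ≤ c / 2)
      linarith
    have h4 : 0 ≤ k r ^ 2 + Q r * |w r| ^ (p - 2) - n / 2 * (n / 2 - 1) / r ^ 2 - ω ^ 2 := by
      rw [hω2]
      linarith
    have h5 := (hpos r hr.1.le).le
    rw [neg_nonpos]
    positivity
  have hWa : W a < 0 := by
    have h1 := hpos a le_rfl
    have h2 : W a = -(ω * (a ^ (n / 2) * (σ * w a))) := by
      simp only [hW_def, sub_self, mul_zero, Real.sin_zero, Real.cos_zero]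
      ring
    have h3 : 0 < a ^ (n / 2) := Real.rpow_pos_of_pos (by linarith) _
    rw [h2, neg_lt_zero]
    positivity
  have hWe : 0 < W e := by
    have h1 := hpos e hae.le
    have h2 : W e = ω * (e ^ (n / 2) * (σ * w e)) := by
      simp only [hW_def, hωe, Real.sin_pi, Real.cos_pi]
      ring
    have h3 : 0 < e ^ (n / 2) := Real.rpow_pos_of_pos (by linarith) _
    rw [h2]
    positivity
  have := hanti (left_mem_Icc.2 hae.le) (right_mem_Icc.2 hae.le) hae.le
  linarith

end Oscillation

/-- A radial function whose profile has arbitrarily large zeros is oscillating. -/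
theorem isOscillating_of_profile {E : Type*} [NormedAddCommGroup E] [NormedSpace ℝ E]
    [Nontrivial E] {u : E → ℝ} {w : ℝ → ℝ} (hu : ∀ x, u x = w ‖x‖)
    (hw : ∀ R, ∃ r, R ≤ r ∧ w r = 0) : IsOscillating u := by
  choose z hz hz0 using hw
  have hex : ∀ m : ℕ, ∃ x : E, ‖x‖ = z m := fun m =>
    exists_norm_eq E ((Nat.cast_nonneg m).trans (hz m))
  choose x hx using hex
  refine ⟨x, fun m => by rw [hu, hx, hz0], fun hbdd => ?_⟩
  obtain ⟨C, hC⟩ := hbdd.exists_norm_le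
  obtain ⟨m, hm⟩ := exists_nat_gt C
  have h1 := hC (x m) (mem_range_self m)
  rw [hx] at h1
  linarith [hz m]

/-! ### Continuous dependence on the initial value -/

section Dependence

variable {p n α β kinf Qinf b r : ℝ} {k Q w φ w₁ φ₁ w₂ φ₂ : ℝ → ℝ}

theorem lipschitzBound_nonneg (hp : 2 < p) (hb : 0 ≤ b) : 0 ≤ lipschitzBound p k Q Qinf b := by
  have : 0 ≤ p - 1 := by linarith
  unfold lipschitzBound
  positivity

/-- Gronwall for the squared distance. The singular friction contributes -2 n r (φ₁ - φ₂)², which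
has the favourable sign. -/
theorem RadialSolution.sq_sub_add_sq_sub_le (hc : DecreasingCoeffs k Q kinf Qinf)
    (hp : 2 < p) (hn : 0 ≤ n) (h₁ : RadialSolution n (nonlinearity p k Q) α w₁ φ₁)
    (hwb₁ : ∀ r, 0 ≤ r → |w₁ r| ≤ b) (h₂ : RadialSolution n (nonlinearity p k Q) β w₂ φ₂)
    (hwb₂ : ∀ r, 0 ≤ r → |w₂ r| ≤ b) (hr : 0 ≤ r) :
    (w₁ r - w₂ r) ^ 2 + (r * (φ₁ r - φ₂ r)) ^ 2 ≤
      (α - β) ^ 2 * Real.exp ((1 + lipschitzBound p k Q Qinf b) * r) := by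
  set L := lipschitzBound p k Q Qinf b with hL_def
  set H : ℝ → ℝ := fun r => (w₁ r - w₂ r) ^ 2 + (r * φ₁ r - r * φ₂ r) ^ 2 with hH_def
  have hd : ∀ r, 0 < r → HasDerivAt H _ r := fun r hr =>
    (((h₁.hasDerivAt r).sub (h₂.hasDerivAt r)).pow 2).add
      (((h₁.hasDerivAt_deriv r hr).sub (h₂.hasDerivAt_deriv r hr)).pow 2)
  have hexp : ∀ r, HasDerivAt (fun r => Real.exp (-((1 + L) * r)))
      (Real.exp (-((1 + L) * r)) * -((1 + L) * 1)) r := fun r =>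
    (((hasDerivAt_id r).const_mul (1 + L)).neg).exp
  have hHc : Continuous H := by
    have t1 := h₁.continuous
    have t2 := h₂.continuous
    have t3 := h₁.continuous_fst
    have t4 := h₂.continuous_fst
    fun_prop
  have hanti : AntitoneOn (fun r => H r * Real.exp (-((1 + L) * r))) (Ici 0) := by
    refine antitoneOn_of_hasDerivWithinAt_nonpos (convex_Ici 0)
      (hHc.mul (by fun_prop)).continuousOn (fun r hr => ?_) (fun r hr => ?_)
      (f' := fun r => (2 * (w₁ r - w₂ r) * (r * φ₁ r - r * φ₂ r) +
        2 * (r * φ₁ r - r * φ₂ r) * ((-(n * φ₁ r) - nonlinearity p k Q r (w₁ r)) -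
          (-(n * φ₂ r) - nonlinearity p k Q r (w₂ r)))) * Real.exp (-((1 + L) * r)) +
        H r * (Real.exp (-((1 + L) * r)) * -((1 + L) * 1)))
    · rw [interior_Ici] at hr
      refine (((hd r hr).mul (hexp r)).congr_deriv ?_).hasDerivWithinAt
      simp only [Nat.reduceSub, pow_one, Nat.cast_ofNat, Pi.sub_apply]
    · rw [interior_Ici] at hr
      have hr0 : 0 < r := hr
      have h1 := hc.abs_nonlinearity_sub_le hp hr0.le (hwb₁ r hr0.le) (hwb₂ r hr0.le)
      rw [← hL_def] at h1
      set d := w₁ r - w₂ r with hd_def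
      set e := r * φ₁ r - r * φ₂ r with he_def
      set g := nonlinearity p k Q r (w₁ r) - nonlinearity p k Q r (w₂ r) with hg_def
      have h2 : -(e * g) ≤ L * (|e| * |d|) := by
        calc -(e * g) ≤ |e| * |g| := by rw [← abs_mul]; exact neg_le_abs _
          _ ≤ |e| * (L * |d|) := by gcongr
          _ = _ := by ring
      have hL : 0 ≤ L := by
        rw [hL_def]
        exact lipschitzBound_nonneg hp ((abs_nonneg _).trans (hwb₁ 0 le_rfl))
      have h3 : |e| * |d| ≤ (d ^ 2 + e ^ 2) / 2 := by
        rw [← sq_abs d, ← sq_abs e]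
        nlinarith [sq_nonneg (|d| - |e|)]
      have h4 : 0 ≤ n * (φ₁ r - φ₂ r) * e := by
        have : n * (φ₁ r - φ₂ r) * e = n * r * (φ₁ r - φ₂ r) ^ 2 := by
          rw [he_def]
          ring
        rw [this]
        positivity
      have h5 : 2 * d * e ≤ d ^ 2 + e ^ 2 := by nlinarith [sq_nonneg (d - e)]
      have h6 := mul_le_mul_of_nonneg_left h3 hL
      have h7 : 2 * d * e + 2 * e * ((-(n * φ₁ r) - nonlinearity p k Q r (w₁ r)) -
          (-(n * φ₂ r) - nonlinearity p k Q r (w₂ r))) - (1 + L) * (d ^ 2 + e ^ 2) ≤ 0 := by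
        have : 2 * e * ((-(n * φ₁ r) - nonlinearity p k Q r (w₁ r)) -
          (-(n * φ₂ r) - nonlinearity p k Q r (w₂ r))) =
            -2 * (n * (φ₁ r - φ₂ r) * e) - 2 * (e * g) := by
          rw [hg_def]
          ring
        rw [this]
        linarith
      have h8 := mul_nonpos_of_nonpos_of_nonneg h7 (Real.exp_pos (-((1 + L) * r))).le
      simp only [hH_def, ← hd_def, ← he_def]
      linarith
  have h1 := hanti self_mem_Ici hr hr
  simp only [hH_def, zero_mul, sub_self, mul_zero, neg_zero, Real.exp_zero, mul_one,
    h₁.apply_zero, h₂.apply_zero, Real.exp_neg] at h1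
  rw [← div_eq_mul_inv, div_le_iff₀ (Real.exp_pos _)] at h1
  have h2 : r * (φ₁ r - φ₂ r) = r * φ₁ r - r * φ₂ r := by ring
  rw [h2]
  simpa using h1

/-- Closeness of w' = r φ says nothing about φ near 0. Instead the mean value theorem is applied to
s^n (w₁' - w₂'), whose derivative contains only the difference of the nonlinearities. -/
theorem RadialSolution.abs_fst_sub_le (hc : DecreasingCoeffs k Q kinf Qinf)
    (hp : 2 < p) (hn : 0 < n) (h₁ : RadialSolution n (nonlinearity p k Q) α w₁ φ₁)
    (hwb₁ : ∀ r, 0 ≤ r → |w₁ r| ≤ b) (h₂ : RadialSolution n (nonlinearity p k Q) β w₂ φ₂)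
    (hwb₂ : ∀ r, 0 ≤ r → |w₂ r| ≤ b) (hr : 0 < r) {δ : ℝ}
    (hδ : ∀ s, 0 ≤ s → s ≤ r → |w₁ s - w₂ s| ≤ δ) :
    |φ₁ r - φ₂ r| ≤ lipschitzBound p k Q Qinf b * δ := by
  set L := lipschitzBound p k Q Qinf b with hL_def
  have hL : 0 ≤ L := lipschitzBound_nonneg hp ((abs_nonneg _).trans (hwb₁ 0 le_rfl))
  set D : ℝ → ℝ := fun s => s ^ n * (s * φ₁ s - s * φ₂ s) with hD_def
  have hDc : Continuous D := by
    have t1 : Continuous fun s : ℝ => s ^ n := Real.continuous_rpow_const hn.le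
    have t3 := h₁.continuous_fst
    have t4 := h₂.continuous_fst
    fun_prop
  have hDd : ∀ s, 0 < s → HasDerivAt D
      (-(s ^ n * (nonlinearity p k Q s (w₁ s) - nonlinearity p k Q s (w₂ s)))) s := fun s hs => by
    have t1 := (Real.hasDerivAt_rpow_const (p := n) (Or.inl hs.ne')).mul
      ((h₁.hasDerivAt_deriv s hs).sub (h₂.hasDerivAt_deriv s hs))
    refine t1.congr_deriv ?_
    simp only [Pi.sub_apply]
    rw [Real.rpow_sub_one hs.ne']
    field_simp
    ring
  obtain ⟨s, hs, hslope⟩ := exists_hasDerivAt_eq_slope D _ hr hDc.continuousOn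
    (fun s hs => hDd s hs.1)
  have h1 := hc.abs_nonlinearity_sub_le hp hs.1.le (hwb₁ s hs.1.le) (hwb₂ s hs.1.le)
  rw [← hL_def] at h1
  have h2 := hδ s hs.1.le hs.2.le
  have h3 : s ^ n ≤ r ^ n := by
    have := hs.1.le
    have := hs.2.le
    gcongr
  have hrn : 0 < r ^ n := by positivity
  have h4 : r ^ n * (φ₁ r - φ₂ r) =
      -(s ^ n * (nonlinearity p k Q s (w₁ s) - nonlinearity p k Q s (w₂ s))) := by
    rw [hslope, sub_zero, eq_div_iff hr.ne']
    simp only [hD_def]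
    ring
  have h5 : r ^ n * |φ₁ r - φ₂ r| ≤ r ^ n * (L * δ) := by
    rw [← abs_of_pos hrn, ← abs_mul, abs_of_pos hrn, h4, abs_neg, abs_mul,
      abs_of_nonneg (Real.rpow_nonneg hs.1.le n)]
    calc _ ≤ r ^ n * (L * |w₁ s - w₂ s|) := by gcongr
      _ ≤ _ := by gcongr
  exact le_of_mul_le_mul_left h5 hrn

/-- Energy decay from R on: smallness at R persists, with constants depending on b but not on the
solution. -/
theorem RadialSolution.sq_add_sq_le_of_le (hc : DecreasingCoeffs k Q kinf Qinf)
    (hp : 2 < p) (hn : 0 ≤ n) (h : RadialSolution n (nonlinearity p k Q) α w φ)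
    (hwb : ∀ r, 0 ≤ r → |w r| ≤ b) {R : ℝ} (hR : 0 ≤ R) (hr : R ≤ r) :
    energyLower p kinf Qinf b * (w r ^ 2 + (r * φ r) ^ 2) ≤
      energyUpper p k Q Qinf b * (w R ^ 2 + (R * φ R) ^ 2) :=
  (hc.energyLower_mul_le hp (hR.trans hr) (hwb r (hR.trans hr)) (r * φ r)).trans
    ((h.energy_antitoneOn hc hp hn hR (hR.trans hr : (0 : ℝ) ≤ r) hr).trans
      (hc.le_energyUpper_mul hp hR (hwb R hR) (R * φ R)))

theorem sub_sq_le_two_mul (x y : ℝ) : (x - y) ^ 2 ≤ 2 * x ^ 2 + 2 * y ^ 2 := by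
  nlinarith [sq_nonneg (x + y)]

/-- Solutions depend continuously on the initial value, uniformly on the half-line. -/
theorem RadialSolution.exists_delta (hc : DecreasingCoeffs k Q kinf Qinf)
    (hp : 2 < p) (hn : 1 ≤ n) (hb : Admissible p kinf Qinf b)
    (h₁ : RadialSolution n (nonlinearity p k Q) α w₁ φ₁)
    (hwb₁ : ∀ r, 0 ≤ r → |w₁ r| ≤ b) {ε : ℝ} (hε : 0 < ε) :
    ∃ δ > 0, ∀ β w₂ φ₂, RadialSolution n (nonlinearity p k Q) β w₂ φ₂ →
      (∀ r, 0 ≤ r → |w₂ r| ≤ b) → |β - α| < δ → ∀ r, 0 ≤ r →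
        |w₂ r - w₁ r| ≤ ε ∧ |r * (φ₂ r - φ₁ r)| ≤ ε ∧ |φ₂ r - φ₁ r| ≤ ε := by
  set c := energyLower p kinf Qinf b with hc_def
  set K := energyUpper p k Q Qinf b with hK_def
  have hcpos : 0 < c := hb.energyLower_pos
  have hKpos : 0 < K := hb.energyUpper_pos
  set L := lipschitzBound p k Q Qinf b with hL_def
  have hL : 0 ≤ L := lipschitzBound_nonneg hp hb.1
  -- 10 = 2(1 + 4): on the tail the reference solution has w² + w'² ≤ ε²/10 and the nearby one at
  -- most four times as much.
  set η := c * ε ^ 2 / (10 * K) with hη_def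
  have hη : 0 < η := by positivity
  obtain ⟨R, hR1, hRη⟩ : ∃ R, 1 ≤ R ∧ w₁ R ^ 2 + (R * φ₁ R) ^ 2 < η := by
    have h1 := (h₁.tendsto_sq_add_sq hc hp hn hb hwb₁).eventually (gt_mem_nhds hη)
    obtain ⟨R, hR⟩ := ((eventually_ge_atTop 1).and h1).exists
    exact ⟨R, hR⟩
  have hR0 : 0 ≤ R := by linarith
  -- With ρ = ε/(L + 1) both ρ ≤ ε and L ρ ≤ ε hold; the latter controls φ. The exponential in δ
  -- offsets the Gronwall growth up to R.
  set η' := min η ((ε / (L + 1)) ^ 2) with hη'_def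
  have hη' : 0 < η' := lt_min hη (by positivity)
  set δ := √(η' * Real.exp (-((1 + L) * R))) with hδ_def
  have hδ : 0 < δ := Real.sqrt_pos.2 (by positivity)
  refine ⟨δ, hδ, fun β w₂ φ₂ h₂ hwb₂ hβ => ?_⟩
  have hH : ∀ r, 0 ≤ r → r ≤ R → (w₂ r - w₁ r) ^ 2 + (r * (φ₂ r - φ₁ r)) ^ 2 ≤ η' := by
    intro r hr hrR
    have h3 := h₂.sq_sub_add_sq_sub_le hc hp (by linarith) hwb₂ h₁ hwb₁ hr
    rw [← hL_def] at h3
    have h4 : (β - α) ^ 2 ≤ η' * Real.exp (-((1 + L) * R)) := by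
      rw [← Real.sq_sqrt (by positivity : 0 ≤ η' * Real.exp (-((1 + L) * R))), ← sq_abs]
      gcongr
    calc _ ≤ (β - α) ^ 2 * Real.exp ((1 + L) * r) := h3
      _ ≤ η' * Real.exp (-((1 + L) * R)) * Real.exp ((1 + L) * R) := by gcongr
      _ = η' := by rw [mul_assoc, ← Real.exp_add, neg_add_cancel, Real.exp_zero, mul_one]
  set ρ := ε / (L + 1) with hρ_def
  have hρ : 0 < ρ := by positivity
  have hρε : ρ ≤ ε := div_le_self hε.le (by linarith)
  have hLρ : L * ρ ≤ ε := by
    rw [hρ_def, mul_div_assoc', div_le_iff₀ (by positivity)]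
    nlinarith
  have hnear : ∀ r, 0 ≤ r → r ≤ R → |w₂ r - w₁ r| ≤ ρ ∧ |r * (φ₂ r - φ₁ r)| ≤ ρ := by
    intro r hr hrR
    have h3 := (hH r hr hrR).trans (min_le_right _ _)
    exact ⟨abs_le_of_sq_le_sq (by linarith [sq_nonneg (r * (φ₂ r - φ₁ r))]) hρ.le,
      abs_le_of_sq_le_sq (by linarith [sq_nonneg (w₂ r - w₁ r)]) hρ.le⟩
  intro r hr
  rcases le_total r R with hrR | hRr
  · obtain ⟨h3, h4⟩ := hnear r hr hrR
    refine ⟨h3.trans hρε, h4.trans hρε, ?_⟩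
    have hpos : ∀ s, 0 < s → s ≤ R → |φ₂ s - φ₁ s| ≤ ε := fun s hs hsR =>
      (h₂.abs_fst_sub_le hc hp (by linarith) hwb₂ h₁ hwb₁ hs
        fun t ht hts => (hnear t ht (hts.trans hsR)).1).trans hLρ
    rcases hr.eq_or_lt with rfl | hr0
    · have h5 : Tendsto (fun s => |φ₂ s - φ₁ s|) (𝓝[>] 0) (𝓝 |φ₂ 0 - φ₁ 0|) :=
        ((h₂.continuous_fst.sub h₁.continuous_fst).abs.tendsto 0).mono_left inf_le_left
      refine le_of_tendsto h5 ?_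
      filter_upwards [Ioc_mem_nhdsGT (by linarith : (0 : ℝ) < R)] with s hs
      exact hpos s hs.1 hs.2
    · exact hpos r hr0 hrR
  · have hr1 : 1 ≤ r := hR1.trans hRr
    have h3 := h₁.sq_add_sq_le_of_le hc hp (by linarith) hwb₁ hR0 hRr
    have h4 := h₂.sq_add_sq_le_of_le hc hp (by linarith) hwb₂ hR0 hRr
    have h5 := (hH R hR0 le_rfl).trans (min_le_left _ _)
    have h6 : w₂ R ^ 2 + (R * φ₂ R) ^ 2 ≤ 4 * η := by
      have t1 := sub_sq_le_two_mul (w₂ R - w₁ R) (-w₁ R)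
      have t2 := sub_sq_le_two_mul (R * (φ₂ R - φ₁ R)) (-(R * φ₁ R))
      rw [sub_neg_eq_add, sub_add_cancel, neg_sq] at t1
      rw [sub_neg_eq_add, mul_sub, sub_add_cancel, neg_sq, ← mul_sub] at t2
      linarith
    have hKη : K * η = c * (ε ^ 2 / 10) := by
      rw [hη_def]
      field_simp
    have h7 : w₁ r ^ 2 + (r * φ₁ r) ^ 2 ≤ ε ^ 2 / 10 := by
      refine le_of_mul_le_mul_left (h3.trans ?_) hcpos
      rw [← hKη]
      gcongr
    have h8 : w₂ r ^ 2 + (r * φ₂ r) ^ 2 ≤ 4 * (ε ^ 2 / 10) := by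
      refine le_of_mul_le_mul_left (h4.trans ?_) hcpos
      have : c * (4 * (ε ^ 2 / 10)) = K * (4 * η) := by linarith
      rw [this]
      gcongr
    have h9 : |r * (φ₂ r - φ₁ r)| ≤ ε := by
      refine abs_le_of_sq_le_sq ?_ hε.le
      have t1 := sub_sq_le_two_mul (r * φ₂ r) (r * φ₁ r)
      rw [← mul_sub] at t1
      linarith [sq_nonneg (w₁ r), sq_nonneg (w₂ r), sq_nonneg ε]
    refine ⟨?_, h9, le_trans ?_ h9⟩
    · refine abs_le_of_sq_le_sq ?_ hε.le
      linarith [sub_sq_le_two_mul (w₂ r) (w₁ r), sq_nonneg (r * φ₁ r), sq_nonneg (r * φ₂ r),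
        sq_nonneg ε]
    · rw [abs_mul, abs_of_nonneg hr]
      exact le_mul_of_one_le_left (abs_nonneg _) hr1

end Dependence

/-! ### The interval of initial values -/

/-- The initial values below some admissible energy level. -/
def initialValues (p : ℝ) (k Q : ℝ → ℝ) (kinf Qinf : ℝ) : Set ℝ :=
  {α | ∃ b, Admissible p kinf Qinf b ∧ |α| ≤ b ∧
    primitive p (k 0) (Q 0) α < primitive p kinf Qinf b}

section InitialValues

variable {p kinf Qinf b α : ℝ} {k Q : ℝ → ℝ}

/-- One b serves a whole neighbourhood of α. This gives openness of the interval and the common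
bound needed for continuous dependence. -/
theorem DecreasingCoeffs.eventually_lt (hc : DecreasingCoeffs k Q kinf Qinf)
    (hp : 2 < p) (hα : |α| ≤ b)
    (hlt : primitive p (k 0) (Q 0) α < primitive p kinf Qinf b) :
    ∀ᶠ β in 𝓝 α, |β| ≤ b ∧ primitive p (k 0) (Q 0) β < primitive p kinf Qinf b := by
  have h1 : ∀ᶠ β in 𝓝 α, |β| < b :=
    (continuous_abs.tendsto α).eventually (gt_mem_nhds (hc.abs_lt_of_primitive_lt hp hα hlt))
  have h2 := ((continuous_primitive hp (k 0) (Q 0)).tendsto α).eventually (gt_mem_nhds hlt)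
  filter_upwards [h1, h2] with β h3 h4 using ⟨h3.le, h4⟩

theorem DecreasingCoeffs.isOpen_initialValues (hc : DecreasingCoeffs k Q kinf Qinf)
    (hp : 2 < p) : IsOpen (initialValues p k Q kinf Qinf) := by
  rw [isOpen_iff_mem_nhds]
  rintro α ⟨b, hb, hα, hlt⟩
  filter_upwards [hc.eventually_lt hp hα hlt] with β hβ using ⟨b, hb, hβ⟩

theorem DecreasingCoeffs.mem_initialValues_of_abs_le (hc : DecreasingCoeffs k Q kinf Qinf)
    (hp : 2 < p) {β : ℝ} (hα : α ∈ initialValues p k Q kinf Qinf) (hβ : |β| ≤ |α|) :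
    β ∈ initialValues p k Q kinf Qinf := by
  obtain ⟨b, hb, hαb, hlt⟩ := hα
  refine ⟨b, hb, hβ.trans hαb, lt_of_le_of_lt ?_ hlt⟩
  have := (strictMonoOn_primitive hp hc.pos hb (hc.le_left 0 le_rfl)
    (hc.le_right 0 le_rfl)).monotoneOn ⟨abs_nonneg β, hβ.trans hαb⟩ ⟨abs_nonneg α, hαb⟩ hβ
  simpa using this

theorem DecreasingCoeffs.ordConnected_initialValues (hc : DecreasingCoeffs k Q kinf Qinf)
    (hp : 2 < p) : (initialValues p k Q kinf Qinf).OrdConnected := by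
  refine ⟨fun x hx y hy z hz => ?_⟩
  rcases le_total |x| |y| with h | h
  · exact hc.mem_initialValues_of_abs_le hp hy ((abs_le_max_abs_abs hz.1 hz.2).trans
      (max_le h le_rfl))
  · exact hc.mem_initialValues_of_abs_le hp hx ((abs_le_max_abs_abs hz.1 hz.2).trans
      (max_le le_rfl h))

theorem DecreasingCoeffs.zero_mem_initialValues (hc : DecreasingCoeffs k Q kinf Qinf)
    (hp : 2 < p) : 0 ∈ initialValues p k Q kinf Qinf := by
  have hkinf := hc.pos
  have h1 : Tendsto (fun b : ℝ => max (-Qinf) 0 * b ^ (p - 2)) (𝓝[>] 0) (𝓝 0) := by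
    have h2 : Continuous fun b : ℝ => max (-Qinf) 0 * b ^ (p - 2) :=
      continuous_const.mul (Real.continuous_rpow_const (by linarith))
    have h3 := (h2.tendsto 0).mono_left (inf_le_left : 𝓝[>] (0 : ℝ) ≤ 𝓝 0)
    rwa [Real.zero_rpow (by linarith), mul_zero] at h3
  obtain ⟨b, hb, hb0⟩ := ((h1.eventually (gt_mem_nhds (by positivity : 0 < kinf ^ 2))).and
    self_mem_nhdsWithin).exists
  have hb0' : 0 < b := hb0
  have hadm : Admissible p kinf Qinf b := ⟨hb0'.le, hb⟩
  refine ⟨b, hadm, by simpa using hb0'.le, ?_⟩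
  have h4 := strictMonoOn_primitive hp hkinf hadm le_rfl le_rfl ⟨le_rfl, hb0'.le⟩
    ⟨hb0'.le, le_rfl⟩ hb0'
  rwa [primitive_zero hp] at h4 ⊢

/-- Here every b ≥ 0 is admissible and the limit primitive grows at least like kinf² b²/2, so it
exceeds any initial energy. -/
theorem initialValues_eq_univ (hp : 2 < p) (hkinf : 0 < kinf) (hQ : 0 ≤ Qinf) :
    initialValues p k Q kinf Qinf = univ := by
  refine eq_univ_of_forall fun α => ?_
  have h1 : Tendsto (fun b : ℝ => kinf ^ 2 / 2 * b ^ 2) atTop atTop :=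
    (tendsto_pow_atTop two_ne_zero).const_mul_atTop (by positivity)
  obtain ⟨b, hb, hbα⟩ := ((h1.eventually (eventually_gt_atTop (primitive p (k 0) (Q 0) α))).and
    (eventually_ge_atTop |α|)).exists
  refine ⟨b, ⟨(abs_nonneg α).trans hbα, ?_⟩, hbα, hb.trans_le ?_⟩
  · rw [max_eq_right (by linarith), zero_mul]
    positivity
  · have : 0 ≤ Qinf / p * |b| ^ p := by positivity
    unfold primitive
    linarith

/-- The maximal amplitude associated with an initial value. -/
theorem DecreasingCoeffs.exists_amplitude (hc : DecreasingCoeffs k Q kinf Qinf)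
    (hp : 2 < p) (hb : Admissible p kinf Qinf b) (hα : |α| ≤ b)
    (hlt : primitive p (k 0) (Q 0) α < primitive p kinf Qinf b) :
    ∃ a, 0 ≤ a ∧ a ≤ b ∧ primitive p kinf Qinf a = primitive p (k 0) (Q 0) α := by
  have h1 := primitive_nonneg hp hc.pos hb (hc.le_left 0 le_rfl) (hc.le_right 0 le_rfl) hα
  obtain ⟨a, ha, haeq⟩ := intermediate_value_Icc hb.1 (continuous_primitive hp kinf Qinf).continuousOn
    ⟨by rwa [primitive_zero hp], hlt.le⟩
  exact ⟨a, ha.1, ha.2, haeq⟩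

end InitialValues

/-! ### The family of solutions -/

section Family

set_option maxSynthPendingDepth 3

variable {E : Type*} [NormedAddCommGroup E] [InnerProductSpace ℝ E]
  {p n kinf Qinf b α : ℝ} {k Q w φ : ℝ → ℝ}

/-- A family of functions is continuous in `C²` if its jets are uniformly continuous. -/
theorem C2Function.continuousWithinAt_iff {u : ℝ → C2Function E} {I : Set ℝ} {α : ℝ} :
    ContinuousWithinAt u I α ↔
      ∀ ε > 0, ∀ᶠ β in 𝓝[I] α, ∀ x, dist ((u α).jet x) ((u β).jet x) < ε := by
  rw [ContinuousWithinAt, nhds_induced, tendsto_comap_iff,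
    UniformFun.tendsto_iff_tendstoUniformly]
  exact Metric.tendstoUniformly_iff

theorem RadialSolution.continuousOn_family (hc : DecreasingCoeffs k Q kinf Qinf)
    (hp : 2 < p) (hn : 1 ≤ n) {w φ : ℝ → ℝ → ℝ} {u : ℝ → C2Function E}
    (h : ∀ α ∈ initialValues p k Q kinf Qinf,
      RadialSolution n (nonlinearity p k Q) α (w α) (φ α))
    (hu : ∀ α ∈ initialValues p k Q kinf Qinf, ∀ x, u α x = w α ‖x‖) :
    ContinuousOn u (initialValues p k Q kinf Qinf) := by
  intro α hα
  rw [C2Function.continuousWithinAt_iff]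
  intro ε hε
  obtain ⟨b, hb, hαb, hlt⟩ := id hα
  set L := lipschitzBound p k Q Qinf b with hL_def
  have hL : 0 ≤ L := lipschitzBound_nonneg hp hb.1
  -- The jet distance is at most (4 + n + L) ε': one each for w and w', two for φ in the Hessian, n
  -- + L for w''. The 5 makes the inequality strict.
  set ε' := ε / (5 + n + L) with hε'_def
  have hε' : 0 < ε' := by positivity
  have hwb : ∀ r, 0 ≤ r → |w α r| ≤ b := fun r hr =>
    ((h α hα).abs_lt_of_primitive_lt hc hp (by linarith) hαb hlt (fun _ _ _ _ => rfl) hr).le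
  obtain ⟨δ, hδ, hclose⟩ := (h α hα).exists_delta hc hp hn hb hwb hε'
  filter_upwards [self_mem_nhdsWithin, mem_nhdsWithin_of_mem_nhds (Metric.ball_mem_nhds α hδ),
    mem_nhdsWithin_of_mem_nhds (hc.eventually_lt hp hαb hlt)] with β hβI hβδ hβ x
  have hwb' : ∀ r, 0 ≤ r → |w β r| ≤ b := fun r hr =>
    ((h β hβI).abs_lt_of_primitive_lt hc hp (by linarith) hβ.1 hβ.2 (fun _ _ _ _ => rfl) hr).le
  have hx := norm_nonneg x
  obtain ⟨h1, h2, h3⟩ := hclose β _ _ (h β hβI) hwb' hβδ ‖x‖ hx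
  have h4 : |profileSecond p n k Q (w β) (φ β) ‖x‖ - profileSecond p n k Q (w α) (φ α) ‖x‖| ≤
      n * ε' + L * ε' := by
    have t1 := hc.abs_nonlinearity_sub_le hp hx (hwb' _ hx) (hwb _ hx)
    have t2 : profileSecond p n k Q (w β) (φ β) ‖x‖ - profileSecond p n k Q (w α) (φ α) ‖x‖ =
        -(n * (φ β ‖x‖ - φ α ‖x‖)) -
          (nonlinearity p k Q ‖x‖ (w β ‖x‖) - nonlinearity p k Q ‖x‖ (w α ‖x‖)) := by
      unfold profileSecond
      ring
    rw [t2]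
    refine (abs_sub _ _).trans ?_
    rw [abs_neg, abs_mul, abs_of_pos (by linarith : 0 < n)]
    refine add_le_add (by gcongr) (t1.trans (by gcongr))
  have h5 := dist_jet_le ((h β hβI).radialJet hc hp) ((h α hα).radialJet hc hp) (hu β hβI)
    (hu α hα) x
  rw [dist_comm] at h5
  have h6 : ε = (5 + n + L) * ε' := by
    rw [hε'_def]
    field_simp
  rw [h6]
  linarith

theorem RadialSolution.solvesHelmholtz {N : ℕ} {m : ℕ} (hN : N = m + 1)
    (hc : DecreasingCoeffs k Q kinf Qinf) (hp : 2 < p)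
    (h : RadialSolution m (nonlinearity p k Q) α w φ)
    {u : C2Function (EuclideanSpace ℝ (Fin N))} (hu : ∀ x, u x = w ‖x‖) :
    SolvesHelmholtz k Q p u := by
  intro x
  have e : u.toFun = fun y : EuclideanSpace ℝ (Fin N) => w ‖y‖ := funext hu
  rw [e, (h.radialJet hc hp).laplacian_eq x, finrank_euclideanSpace_fin]
  have hN' : (N : ℝ) = m + 1 := by rw [hN]; push_cast; rfl
  rw [hN']
  simp only [profileSecond, nonlinearity]
  ring

end Family

end NonlinearHelmholtz

end

/-! ### Assembly of the main theorem. -/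

open NonlinearHelmholtz in
theorem corollary2p7 (N : ℕ) (hN : 2 ≤ N) (p : ℝ) (hp : 2 < p)
    (k Q : ℝ → ℝ) (kinf Qinf : ℝ)
    (hk : ContDiffOn ℝ 1 k (Set.Ici 0)) (hQ : ContDiffOn ℝ 1 Q (Set.Ici 0))
    (hk_anti : AntitoneOn k (Set.Ici 0)) (hQ_anti : AntitoneOn Q (Set.Ici 0))
    (hk_lim : Tendsto k atTop (𝓝 kinf)) (hQ_lim : Tendsto Q atTop (𝓝 Qinf))
    (hkinf : 0 < kinf) :
    ∃ (I : Set ℝ) (u : ℝ → NonlinearHelmholtz.C2Function (EuclideanSpace ℝ (Fin N))),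
      IsOpen I ∧ I.OrdConnected ∧ 0 ∈ I ∧ (0 ≤ Qinf → I = Set.univ) ∧
      IsConnected (u '' I) ∧
      ∀ α ∈ I,
        u α 0 = α ∧
        NonlinearHelmholtz.SolvesHelmholtz k Q p (u α) ∧
        NonlinearHelmholtz.IsOscillating (u α) ∧
        ∃ w : ℝ → ℝ, NonlinearHelmholtz.IsRadialProfile (u α) w ∧ ContDiff ℝ 2 w ∧
          (∃ a : ℝ, 0 ≤ a ∧ max (-Qinf) 0 * a ^ (p - 2) < kinf ^ 2 ∧
            NonlinearHelmholtz.primitive p kinf Qinf a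
              = NonlinearHelmholtz.primitive p (k 0) (Q 0) α ∧
            ∀ r, |w r| ≤ a) ∧
          (∀ r, |deriv w r| ≤ √(2 * NonlinearHelmholtz.primitive p (k 0) (Q 0) α)) ∧
          (α ≠ 0 → ∃ c C : ℝ, 0 < c ∧ 0 < C ∧ ∀ r : ℝ, 1 ≤ r →
            c * r ^ ((1 - (N : ℝ)) / 2) ≤ |w r| + |deriv w r| + |deriv (deriv w) r| ∧
            |w r| + |deriv w r| + |deriv (deriv w) r| ≤ C * r ^ ((1 - (N : ℝ)) / 2)) := by
  have hc : DecreasingCoeffs k Q kinf Qinf :=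
    .of_contDiffOn hk hQ hk_anti hQ_anti hk_lim hQ_lim hkinf
  obtain ⟨m, hNm⟩ : ∃ m, N = m + 1 := ⟨N - 1, by omega⟩
  have hm : (1 : ℝ) ≤ m := by
    have : 1 ≤ m := by omega
    exact_mod_cast this
  have : Nonempty (Fin N) := ⟨⟨0, by omega⟩⟩
  set I := initialValues p k Q kinf Qinf with hI_def
  -- Outside I a default value is used, so that `choose` gives families indexed by all of ℝ.
  have hex : ∀ α, ∃ w φ, α ∈ I → RadialSolution m (nonlinearity p k Q) α w φ := by
    intro α
    by_cases hα : α ∈ I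
    · obtain ⟨b, hb, hαb, hlt⟩ := hα
      obtain ⟨w, φ, h, -⟩ := exists_radialSolution_nonlinearity hc hp m hb hαb hlt
      exact ⟨w, φ, fun _ => h⟩
    · exact ⟨0, 0, fun h => absurd h hα⟩
  choose w φ hsol using hex
  have hexu : ∀ α, ∃ u : C2Function (EuclideanSpace ℝ (Fin N)), α ∈ I → ∀ x, u x = w α ‖x‖ := by
    intro α
    by_cases hα : α ∈ I
    · exact ⟨⟨_, ((hsol α hα).radialJet hc hp).contDiff⟩, fun _ _ => rfl⟩
    · exact ⟨⟨fun _ => 0, contDiff_const⟩, fun h => absurd h hα⟩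
  choose u hu using hexu
  have hcont : ContinuousOn u I := RadialSolution.continuousOn_family hc hp hm hsol hu
  have hord : I.OrdConnected := hc.ordConnected_initialValues hp
  have h0 : 0 ∈ I := hc.zero_mem_initialValues hp
  refine ⟨I, u, hc.isOpen_initialValues hp, hord, h0, initialValues_eq_univ hp hkinf,
    IsConnected.image ⟨⟨0, h0⟩, hord.isPreconnected⟩ u hcont, fun α hα => ?_⟩
  have h := hsol α hα
  have hj := h.radialJet hc hp
  obtain ⟨b, hb, hαb, hlt⟩ := id hα
  -- The energy barrier applies to any solution of the untruncated problem, whichever b produced it.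
  have hwb : ∀ r, 0 ≤ r → |w α r| ≤ b := fun r hr =>
    (h.abs_lt_of_primitive_lt hc hp (by linarith) hαb hlt (fun _ _ _ _ => rfl) hr).le
  obtain ⟨a, ha0, hab, ha⟩ := hc.exists_amplitude hp hb hαb hlt
  refine ⟨?_, h.solvesHelmholtz hNm hc hp (hu α hα),
    isOscillating_of_profile (hu α hα) (h.exists_zero_ge hc hp hb hwb),
    fun r => w α |r|, ⟨fun r => by simp only [abs_neg], fun x => ?_⟩, ?_,
    ⟨a, ha0, (hb.mono hp ha0 hab).2, ha, fun r => ?_⟩, fun r => ?_, fun hα0 => ?_⟩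
  · rw [hu α hα, norm_zero, h.apply_zero]
  · simp only [hu α hα, abs_norm]
  -- The even profile is itself a radial function on the one-dimensional space ℝ.
  · exact hj.contDiff (E := ℝ)
  · exact h.abs_le_of_primitive_eq hc hp (by linarith) hb hwb ha0 hab ha (abs_nonneg r)
  · have h1 := h.abs_deriv_le hc hp (by linarith) hb hwb (abs_nonneg r)
    rwa [hj.deriv_abs, abs_mul, ← abs_abs r, ← abs_mul, abs_abs r]
  · obtain ⟨c, C, hc0, hC0, hcC⟩ := h.exists_two_sided_bound hc hp hm hb hwb hα0
    refine ⟨c, C, hc0, hC0, fun r hr => ?_⟩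
    have hr0 : 0 < r := by linarith
    have hexp : (1 - (N : ℝ)) / 2 = -(m : ℝ) / 2 := by
      rw [hNm]
      push_cast
      ring
    rw [hj.deriv_abs, hj.deriv_deriv_abs hr0, hexp]
    simp only [abs_of_pos hr0]
    exact hcC r hr
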